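/- Definitions. All groups are discrete. A map $\phi: G\to H$ between groups is a quasi-homomorphism if its defect set $\{\phi(y)^{-1}\phi(x)^{-1}\phi(xy) : x,y\in G\}$ is finite. It is a quasi-isomorphism if moreover there is a quasi-homomorphism $\phi': H\to G$ such that $\{\phi'(\phi(g))^{-1}g : g\in G\}$ and $\{\phi(\phi'(h))^{-1}h : h\in H\}$ are finite; $G$ and $H$ are quasi-isomorphic if there is a quasi-isomorphism $G\to H$. For $K\ge 1$, $C\ge 0$, a map $f:X\to Y$ of metric spaces is a $(K,C)$-quasi-isometric embedding if $K^{-1}d(x,x')-C\le d(f(x),f(x'))\le K d(x,x')+C$ for all $x,x'\in X$, and a $(K,C)$-quasi-isometry if moreover every point of $Y$ is within distance $C$ of $f(X)$. A tree is a nonempty simplicial tree with all edges of length $1$, with its path metric. A quasi-tree is a geodesic metric space that is quasi-isometric to a tree. A hyperbolic space is a nonempty geodesic metric space in which, for some $\delta$, all geodesic triangles are $\delta$-slim. A $(K,C)$-quasi-action of $G$ on $X$ is a map $G\times X\to X$, $(g,x)\mapsto gx$, such that each $x\mapsto gx$ is a $(K,C)$-quasi-isometry and $d(g(hx),(gh)x)\le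 C$ for all $g,h\in G$, $x\in X$. All actions below are isometric; an action on $X$ is cobounded if for each $x\in X$ there is a $C$ such that every point of $X$ is within distance $C$ of the orbit $Gx$. A group $G$ - is almost commutative if $\{[x,y] : x,y\in G\}$ is finite; - has property (QFA) if for every quasi-action of $G$ on any tree $X$ there is $x\in X$ whose orbit $Gx$ has finite diameter; - has property (PH') if there are finitely many hyperbolic spaces $X_1,\dots,X_n$ with cobounded actions of $G$ such that the diagonal action of $G$ on $\prod_i X_i$ with the $\ell^1$-metric is proper, i.e. $\{g\in G : \sum_i d(x_i,gx_i)\le R\}$ is finite for all $(x_i)\in\prod_i X_i$ and all $R$; - (if finitely generated) has property (QT') if there are finitely many quasi-trees $X_1,\dots,X_n$ with actions of $G$ such that every orbit map $G\to\prod_i X_i$, $g\mapsto (gx_i)_i$, of the diagonal action is a quasi-isometric embedding for some constants, where $G$ carries the word metric of a finite generating set and the product carries the $\ell^1$-metric. Proposition. Let $G$ and $H$ be quasi-isomorphic groups. 1. $G$ is almost commutative if and only if $H$ is. 2. If $G$ and $H$ are finitely generated, then $G$ has property (QFA) if and only if $H$ does. 3. $G$ has property (PH') if and only if $H$ does. 4.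 If $G$ and $H$ are finitely generated, then $G$ has property (QT') if and only if $H$ does. -/

import Mathlib

universe u v

namespace CoarseGroup

/-! ### Quasi-homomorphisms and quasi-isomorphisms of discrete groups -/

section Groups

variable {G : Type u} {H : Type v} [Group G] [Group H]

/-- The defect set `{φ(y)⁻¹ φ(x)⁻¹ φ(xy)}` of a map between groups. -/
def defectSet (φ : G → H) : Set H :=
  {d | ∃ x y : G, d = (φ y)⁻¹ * (φ x)⁻¹ * φ (x * y)}

/-- A quasi-homomorphism of discrete groups: the defect set is finite. -/
def IsQuasiHom (φ : G → H) : Prop := (defectSet φ).Finite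

/-- Two maps into a discrete group are at finite distance: `{φ(x)⁻¹ ψ(x)}` is finite. -/
def FiniteDist {S : Type*} (φ ψ : S → H) : Prop :=
  {d | ∃ x : S, d = (φ x)⁻¹ * ψ x}.Finite

/-- `φ` is a quasi-isomorphism: a quasi-homomorphism that has a quasi-inverse. -/
def IsQuasiIsomorphism (φ : G → H) : Prop :=
  IsQuasiHom φ ∧ ∃ ψ : H → G, IsQuasiHom ψ ∧ FiniteDist (ψ ∘ φ) id ∧ FiniteDist (φ ∘ ψ) id

variable (G H) in
/-- Two groups are quasi-isomorphic. -/
def QuasiIsomorphic : Prop := ∃ φ : G → H, IsQuasiIsomorphism φ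

variable (G) in
/-- Almost commutative groups: the set of commutators is finite. -/
def AlmostCommutative : Prop := (commutatorSet G).Finite

end Groups

/-! ### Metric notions -/

section Metric

variable {X : Type u} {Y : Type v} [MetricSpace X] [MetricSpace Y]

/-- `(K, C)`-quasi-isometric embedding. -/
structure IsQIEmbedding (K C : ℝ) (f : X → Y) : Prop where
  one_le : 1 ≤ K
  nonneg : 0 ≤ C
  lower : ∀ x y, K⁻¹ * dist x y - C ≤ dist (f x) (f y)
  upper : ∀ x y, dist (f x) (f y) ≤ K * dist x y + C

/-- `(K, C)`-quasi-isometry: a `(K, C)`-quasi-isometric embedding that is `C`-coarsely onto. -/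
structure IsQuasiIsometry (K C : ℝ) (f : X → Y) : Prop extends IsQIEmbedding K C f where
  coarse_onto : ∀ y, ∃ x, dist y (f x) ≤ C

/-- `γ`, restricted to `[0, dist x y]`, is a geodesic from `x` to `y`. -/
structure IsGeodesic (γ : ℝ → X) (x y : X) : Prop where
  source : γ 0 = x
  target : γ (dist x y) = y
  isometry : ∀ s ∈ Set.Icc 0 (dist x y), ∀ t ∈ Set.Icc 0 (dist x y), dist (γ s) (γ t) = |s - t|

variable (X) in
/-- Geodesic metric spaces: any two points are joined by a geodesic. -/
def IsGeodesicSpace : Prop := ∀ x y : X, ∃ γ : ℝ → X, IsGeodesic γ x y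

variable (X) in
/-- (Gromov-)hyperbolic spaces: nonempty geodesic metric spaces all of whose geodesic triangles are
`δ`-slim for some `δ`. -/
def IsHyperbolicSpace : Prop :=
  Nonempty X ∧ IsGeodesicSpace X ∧ ∃ δ : ℝ, ∀ (x y z : X) (α β γ : ℝ → X),
    IsGeodesic α x y → IsGeodesic β y z → IsGeodesic γ x z →
    ∀ t ∈ Set.Icc 0 (dist x z),
      (∃ s ∈ Set.Icc 0 (dist x y), dist (γ t) (α s) ≤ δ) ∨
      (∃ s ∈ Set.Icc 0 (dist y z), dist (γ t) (β s) ≤ δ)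

variable (X) in
/-- `X` is a (simplicial) tree with edges of length one, i.e. the geometric realization of a
connected acyclic graph `T` (in particular `X` is nonempty): `X` is geodesic and `0`-hyperbolic, it
contains the vertices of `T` with the path metric of `T`, and each point of `X` is a vertex
(`v = w`) or lies on an edge of `T` (`dist v w = 1`). -/
def IsMetricTree : Prop :=
  IsGeodesicSpace X ∧
  (∀ x y z w : X, dist x y + dist z w ≤ max (dist x z + dist y w) (dist x w + dist y z)) ∧
  ∃ (V : Set X) (T : SimpleGraph V), T.IsTree ∧
    (∀ v w : V, dist (v : X) (w : X) = (T.dist v w : ℝ)) ∧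
    ∀ x : X, ∃ v w : V, dist (v : X) (w : X) ≤ 1 ∧
      dist (v : X) x + dist x (w : X) = dist (v : X) (w : X)

end Metric

/-- A quasi-tree: a geodesic metric space that is quasi-isometric to a tree. -/
def IsQuasiTree (X : Type u) [MetricSpace X] : Prop :=
  IsGeodesicSpace X ∧ ∃ (T : Type u) (_ : MetricSpace T), IsMetricTree T ∧
    ∃ (K C : ℝ) (f : X → T), IsQuasiIsometry K C f

/-! ### Actions and quasi-actions -/

/-- `ρ` is a `(K, C)`-quasi-action of `G` on `X`. -/
structure IsQuasiAction {G : Type u} [Group G] {X : Type v} [MetricSpace X]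
    (K C : ℝ) (ρ : G → X → X) : Prop where
  quasiIsometry : ∀ g, IsQuasiIsometry K C (ρ g)
  comp : ∀ g h x, dist (ρ g (ρ h x)) (ρ (g * h) x) ≤ C

/-- Property (QFA): every quasi-action on a tree has an orbit of finite diameter. -/
def PropertyQFA (G : Type u) [Group G] : Prop :=
  ∀ (X : Type u) [MetricSpace X], IsMetricTree X →
    ∀ (K C : ℝ) (ρ : G → X → X), IsQuasiAction K C ρ →
      ∃ x : X, Bornology.IsBounded (Set.range fun g => ρ g x)

/-- Cobounded actions: every orbit is coarsely dense. -/
def IsCoboundedAction (G : Type u) [Group G] (X : Type v) [MetricSpace X] [MulAction G X] : Prop :=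
  ∀ x : X, ∃ C : ℝ, ∀ y : X, ∃ g : G, dist y (g • x) ≤ C

/-- The `ℓ¹`-metric on a finite product. -/
noncomputable def l1Dist {n : ℕ} {X : Fin n → Type u} [∀ i, MetricSpace (X i)]
    (x y : ∀ i, X i) : ℝ := ∑ i, dist (x i) (y i)

/-- Property (PH'): there are finitely many hyperbolic spaces with cobounded isometric actions of
`G` whose diagonal action on the `ℓ¹`-product is (metrically) proper. -/
def PropertyPH' (G : Type u) [Group G] : Prop :=
  ∃ (n : ℕ) (X : Fin n → Type u) (_ : ∀ i, MetricSpace (X i)) (_ : ∀ i, MulAction G (X i)),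
    (∀ i, IsIsometricSMul G (X i)) ∧ (∀ i, IsHyperbolicSpace (X i)) ∧
    (∀ i, IsCoboundedAction G (X i)) ∧
    ∀ (x : ∀ i, X i) (R : ℝ), {g : G | l1Dist x (fun i => g • x i) ≤ R}.Finite

/-- The word metric on `G` for a generating set `S`, i.e. the path metric of the Cayley graph in
which `g` is joined to `g * s` for `s ∈ S`. -/
noncomputable def wordDist {G : Type u} [Group G] (S : Set G) (g h : G) : ℝ :=
  ((SimpleGraph.mulCayley S).dist g h : ℝ)

/-- Property (QT') for a finitely generated group: there are finitely many quasi-trees with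
isometric actions of `G` such that the orbit maps of the diagonal action on the `ℓ¹`-product are
quasi-isometric embeddings of `G`, equipped with the word metric of a finite generating set. -/
def PropertyQT' (G : Type u) [Group G] : Prop :=
  ∃ (n : ℕ) (X : Fin n → Type u) (_ : ∀ i, MetricSpace (X i)) (_ : ∀ i, MulAction G (X i)),
    (∀ i, IsIsometricSMul G (X i)) ∧ (∀ i, IsQuasiTree (X i)) ∧
    ∃ S : Set G, S.Finite ∧ Subgroup.closure S = ⊤ ∧
      ∀ x : ∀ i, X i, ∃ K C : ℝ, 1 ≤ K ∧ 0 ≤ C ∧ ∀ g h : G,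
        K⁻¹ * wordDist S g h - C ≤ l1Dist (fun i => g • x i) (fun i => h • x i) ∧
        l1Dist (fun i => g • x i) (fun i => h • x i) ≤ K * wordDist S g h + C

end CoarseGroup

/-!
Let `φ : G → H` be a quasi-isomorphism. Quasi-isomorphism is symmetric, so each property only
has to be transported in one direction.

For a quasi-action of `H` on a space `X`, the composition `F g = φ g • x` of `φ` with an orbit
map is coarsely left-invariant (`IsQuasiAction.exists_coarselyInvariant`): in
`φ (x * y) = φ x * φ y * d` the defect `d` stands next to the base point, which it
moves by a bounded amount. All of `X` need not be moved by a bounded amount, so that `G` does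
not quasi-act on `X` in general; hence `X` is replaced by a space in which the orbit is coarsely
dense.

* Property (QFA): if `G` is finitely generated, the orbit is coarsely connected. A coarse path
  in a tree comes close to all points between its ends (`FourPoint.exists_dist_le_of_chain`), so
  the orbit is coarsely dense in the subtree that it spans (`IsMetricTree.exists_subtree`), and
  `G` quasi-acts on this subtree (`CoarselyInvariant.exists_isQuasiAction`).
* Properties (PH') and (QT'): for isometric actions, the supremum of all translates of the
  metric pulled back by `F` is a left-invariant pseudometric on `G`, within bounded distance of
  the pulled back one. If `X` is hyperbolic and `F` has quasi-convex image, `G` with this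
  pseudometric satisfies the four-point condition and is roughly geodesic, so it is coarsely
  dense in its tight span, which is a hyperbolic geodesic space with an isometric action of `G`
  (`CoarselyInvariant.exists_action`). For (PH'), quasi-convexity holds since the action is
  cobounded. For (QT'), geodesics of a quasi-tree are close to geodesics of the tree
  (`IsQIEmbedding.exists_between_dist_le`); therefore quasi-trees are hyperbolic, and coarsely
  connected subsets are quasi-convex. Properness in (PH') is inherited because `φ` has finite
  fibres, and the comparison with the word metric in (QT') because `φ` is a quasi-isometry for
  word metrics.

For almost commutativity, the defects and all their conjugates form a finite set, as `φ` is
coarsely onto (`IsQuasiIsomorphism.exists_invariant_defect`). Hence `φ` maps commutators into a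
finite set, whose preimage is finite.
-/

universe w

open scoped commutatorElement

namespace CoarseGroup

/-! ### Defects, fibres and commutators -/

section Groups

variable {G : Type u} {H : Type v} [Group G] [Group H]

theorem IsQuasiHom.exists_defect {φ : G → H} (hφ : IsQuasiHom φ) :
    ∃ D : Set H, D.Finite ∧ ∀ x y, ∃ d ∈ D, φ (x * y) = φ x * φ y * d :=
  ⟨defectSet φ, hφ, fun x y => ⟨_, ⟨x, y, rfl⟩, by group⟩⟩

theorem QuasiIsomorphic.symm (h : QuasiIsomorphic G H) : QuasiIsomorphic H G := by
  obtain ⟨φ, hφ, ψ, hψ, h₁, h₂⟩ := h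
  exact ⟨ψ, hψ, φ, hφ, h₂, h₁⟩

theorem FiniteDist.exists_finite {S : Type*} {φ ψ : S → H} (h : FiniteDist φ ψ) :
    ∃ E : Set H, E.Finite ∧ ∀ x, ∃ e ∈ E, ψ x = φ x * e :=
  ⟨_, h, fun x => ⟨_, ⟨x, rfl⟩, by group⟩⟩

theorem IsQuasiIsomorphism.finite_preimage {φ : G → H} (hφ : IsQuasiIsomorphism φ) {A : Set H}
    (hA : A.Finite) : (φ ⁻¹' A).Finite := by
  obtain ⟨-, ψ, -, h, -⟩ := hφ
  obtain ⟨E, hE, hE'⟩ := h.exists_finite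
  refine (Set.Finite.image2 (fun a e => ψ a * e) hA hE).subset fun g hg => ?_
  obtain ⟨e, he, h⟩ := hE' g
  exact ⟨φ g, hg, e, he, h.symm⟩

theorem IsQuasiIsomorphism.exists_coarse_onto {φ : G → H} (hφ : IsQuasiIsomorphism φ) :
    ∃ E : Set H, E.Finite ∧ ∀ h, ∃ g, ∃ e ∈ E, h = φ g * e := by
  obtain ⟨-, ψ, -, -, h⟩ := hφ
  obtain ⟨E, hE, hE'⟩ := h.exists_finite
  exact ⟨E, hE, fun h => ⟨ψ h, hE' h⟩⟩

/-- The defect set of a quasi-isomorphism lies in a finite set that is invariant under conjugation.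
By associativity, `φ z` conjugates a defect `d` into the finite set `D * D * D⁻¹`, and `φ` is
coarsely onto. -/
theorem IsQuasiIsomorphism.exists_invariant_defect {φ : G → H} (hφ : IsQuasiIsomorphism φ) :
    ∃ D : Set H, D.Finite ∧ (∀ h, ∀ d ∈ D, h⁻¹ * d * h ∈ D) ∧
      ∀ x y, ∃ d ∈ D, φ (x * y) = φ x * φ y * d := by
  obtain ⟨E, hE, hE'⟩ := hφ.exists_coarse_onto
  have hD : (defectSet φ).Finite := hφ.1
  refine ⟨{c | ∃ h, ∃ d ∈ defectSet φ, c = h⁻¹ * d * h}, ?_, ?_, ?_⟩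
  · have hF : (Set.image2 (fun p q : H × H => q.2⁻¹ * (p.1 * p.2 * q.1⁻¹) * q.2)
        (defectSet φ ×ˢ defectSet φ) (defectSet φ ×ˢ E)).Finite :=
      Set.Finite.image2 _ (hD.prod hD) (hD.prod hE)
    refine hF.subset ?_
    rintro _ ⟨h, _, ⟨x, y, rfl⟩, rfl⟩
    obtain ⟨z, e, he, rfl⟩ := hE' h
    refine ⟨(_, _), ⟨⟨y, z, rfl⟩, ⟨x, y * z, rfl⟩⟩, (_, e), ⟨⟨x * y, z, rfl⟩, he⟩, ?_⟩
    simp only [mul_assoc x y z]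
    group
  · rintro h _ ⟨k, d, hd, rfl⟩
    exact ⟨k * h, d, hd, by group⟩
  · exact fun x y => ⟨_, ⟨1, _, ⟨x, y, rfl⟩, rfl⟩, by group⟩

theorem AlmostCommutative.of_quasiIsomorphism {φ : G → H} (hφ : IsQuasiIsomorphism φ)
    (hH : AlmostCommutative H) : AlmostCommutative G := by
  obtain ⟨D, hD, hconj, hdef⟩ := hφ.exists_invariant_defect
  -- Since `⁅x, y⁆ * (y * x) = x * y`, the element `φ ⁅x, y⁆` is the product of `⁅φ x, φ y⁆`, a
  -- conjugate of a defect and the inverse of a conjugate of a product of two defects.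
  have hF : (Set.image2 (fun (c : H) (p : H × H) => c * p.1 * p.2) (commutatorSet H)
      (D ×ˢ ((fun d => d⁻¹) '' (Set.image2 (· * ·) D D)))).Finite :=
    Set.Finite.image2 _ hH (hD.prod ((Set.Finite.image2 _ hD hD).image _))
  refine (hφ.finite_preimage hF).subset ?_
  rintro _ ⟨x, y, rfl⟩
  obtain ⟨d₁, hd₁, h₁⟩ := hdef x y
  obtain ⟨d₂, hd₂, h₂⟩ := hdef y x
  obtain ⟨d₃, hd₃, h₃⟩ := hdef ⁅x, y⁆ (y * x)
  have h₄ : ⁅x, y⁆ * (y * x) = x * y := by simp [commutatorElement_def, mul_assoc]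
  rw [h₄, h₁, h₂] at h₃
  refine ⟨⁅φ x, φ y⁆, ⟨φ x, φ y, rfl⟩,
    ((φ y * φ x) * d₁ * (φ y * φ x)⁻¹, ((φ y * φ x) * (d₂ * d₃) * (φ y * φ x)⁻¹)⁻¹), ⟨?_, ?_⟩, ?_⟩
  · simpa using hconj (φ y * φ x)⁻¹ d₁ hd₁
  · refine ⟨_, ⟨_, hconj (φ y * φ x)⁻¹ d₂ hd₂, _, hconj (φ y * φ x)⁻¹ d₃ hd₃, rfl⟩, ?_⟩
    group
  · have : φ ⁅x, y⁆ = φ x * φ y * d₁ * (φ y * φ x * (d₂ * d₃))⁻¹ := by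
      rw [eq_mul_inv_iff_mul_eq, h₃]; group
    rw [this, commutatorElement_def]
    group

/-! ### Word metrics and coarsely connected orbits -/

/-- Any two elements are joined by a chain of right multiplications by generators and their
inverses. -/
theorem reflTransGen_of_closure_eq_top {S : Set G} (hS : Subgroup.closure S = ⊤) (g h : G) :
    Relation.ReflTransGen (fun a b : G => ∃ s ∈ S, b = a * s ∨ b = a * s⁻¹) g h := by
  have key : ∀ k : G, Relation.ReflTransGen
      (fun a b : G => ∃ s ∈ S, b = a * s ∨ b = a * s⁻¹) g (g * k) := by
    intro k
    have hk : k ∈ Subgroup.closure S := by rw [hS]; trivial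
    induction hk using Subgroup.closure_induction_right with
    | one => rw [mul_one]
    | mul_right x _ y hy ih => exact ih.tail ⟨y, hy, Or.inl (mul_assoc _ _ _).symm⟩
    | mul_inv_cancel x _ y hy ih => exact ih.tail ⟨y, hy, Or.inr (mul_assoc _ _ _).symm⟩
  simpa using key (g⁻¹ * h)

theorem mulCayley_connected {S : Set G} (hS : Subgroup.closure S = ⊤) :
    (SimpleGraph.mulCayley S).Connected := by
  have : Nonempty G := ⟨1⟩
  refine ⟨fun g h => ?_⟩
  induction reflTransGen_of_closure_eq_top hS g h with
  | refl => exact SimpleGraph.Reachable.refl _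
  | @tail a b _ hab ih =>
    refine ih.trans ?_
    by_cases hne : a = b
    · rw [hne]
    · refine SimpleGraph.Adj.reachable ((SimpleGraph.mulCayley_adj S a b).2 ⟨hne, ?_⟩)
      obtain ⟨s, hs, rfl | rfl⟩ := hab
      · left; simpa using hs
      · right; simpa using hs

/-- A pseudo-distance on `G` that is bounded by `C` on the edges of the Cayley graph is bounded by
`C` times the word metric. -/
theorem le_mul_wordDist {S : Set G} (hS : Subgroup.closure S = ⊤) {δ : G → G → ℝ} {C : ℝ}
    (h0 : ∀ g, δ g g = 0) (htri : ∀ g h k, δ g k ≤ δ g h + δ h k)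
    (hsymm : ∀ g h, δ g h = δ h g) (hadj : ∀ g, ∀ s ∈ S, δ g (g * s) ≤ C) (g h : G) :
    δ g h ≤ C * wordDist S g h := by
  obtain ⟨w, hw⟩ := (mulCayley_connected hS).exists_walk_length_eq_dist g h
  rw [wordDist, ← hw]
  clear hw
  induction w with
  | nil => simp [h0]
  | @cons a b c hab w ih =>
    have h1 : δ a b ≤ C := by
      obtain ⟨-, h | h⟩ := (SimpleGraph.mulCayley_adj S a b).1 hab
      · simpa using hadj a _ h
      · rw [hsymm]; simpa using hadj b _ h
    have := htri a b c
    push_cast [SimpleGraph.Walk.length_cons]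
    linarith

theorem wordDist_triangle {S : Set G} (hS : Subgroup.closure S = ⊤) (g h k : G) :
    wordDist S g k ≤ wordDist S g h + wordDist S h k := by
  have := (mulCayley_connected hS).dist_triangle (u := g) (v := h) (w := k)
  unfold wordDist
  exact_mod_cast this

theorem wordDist_comm (S : Set G) (g h : G) : wordDist S g h = wordDist S h g := by
  unfold wordDist; rw [SimpleGraph.dist_comm]

theorem wordDist_self (S : Set G) (g : G) : wordDist S g g = 0 := by
  simp [wordDist]

theorem wordDist_nonneg (S : Set G) (g h : G) : 0 ≤ wordDist S g h := Nat.cast_nonneg _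

theorem wordDist_mul_left {S : Set G} (hS : Subgroup.closure S = ⊤) (k g h : G) :
    wordDist S (k * g) (k * h) = wordDist S g h := by
  have key : ∀ k g h : G, wordDist S (k * g) (k * h) ≤ wordDist S g h := by
    intro k g h
    obtain ⟨w, hw⟩ := (mulCayley_connected hS).exists_walk_length_eq_dist g h
    let f : SimpleGraph.mulCayley S →g SimpleGraph.mulCayley S :=
      ⟨fun g => k * g, fun h => SimpleGraph.mulCayley_adj_mul_iff_right.2 h⟩
    have := SimpleGraph.dist_le (w.map f)
    rw [SimpleGraph.Walk.length_map, hw] at this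
    exact Nat.cast_le.2 this
  refine le_antisymm (key k g h) ?_
  simpa using key k⁻¹ (k * g) (k * h)

/-- Quasi-homomorphisms are Lipschitz for word metrics. -/
theorem IsQuasiHom.exists_wordDist_le {φ : G → H} (hφ : IsQuasiHom φ) {S : Set G} (hSf : S.Finite)
    (hS : Subgroup.closure S = ⊤) {S' : Set H} (hS' : Subgroup.closure S' = ⊤) :
    ∃ C : ℝ, 0 ≤ C ∧ ∀ g h, wordDist S' (φ g) (φ h) ≤ C * wordDist S g h := by
  obtain ⟨D, hD, hdef⟩ := hφ.exists_defect
  have hfin : (Set.image2 (fun s d => wordDist S' 1 (φ s * d)) S D).Finite :=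
    Set.Finite.image2 _ hSf hD
  obtain ⟨C, hC⟩ := hfin.bddAbove
  refine ⟨max C 0, le_max_right _ _, le_mul_wordDist hS (δ := fun g h => wordDist S' (φ g) (φ h))
    (fun g => wordDist_self _ _) (fun g h k => wordDist_triangle hS' _ _ _)
    (fun g h => wordDist_comm _ _ _) fun g s hs => le_max_of_le_left ?_⟩
  obtain ⟨d, hd, h⟩ := hdef g s
  have : wordDist S' 1 (φ s * d) ≤ C := hC ⟨s, hs, d, hd, rfl⟩
  rwa [← wordDist_mul_left hS' (φ g), mul_one, ← mul_assoc, ← h] at this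

/-- Quasi-isomorphisms are bi-Lipschitz for word metrics, up to an additive constant. -/
theorem IsQuasiIsomorphism.exists_wordDist_bounds {φ : G → H} (hφ : IsQuasiIsomorphism φ)
    {S : Set G} (hSf : S.Finite) (hS : Subgroup.closure S = ⊤) {S' : Set H} (hSf' : S'.Finite)
    (hS' : Subgroup.closure S' = ⊤) :
    ∃ C : ℝ, 1 ≤ C ∧ ∀ g h, wordDist S' (φ g) (φ h) ≤ C * wordDist S g h ∧
      wordDist S g h ≤ C * wordDist S' (φ g) (φ h) + C := by
  obtain ⟨hφ, ψ, hψ, hψφ, -⟩ := hφ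
  obtain ⟨A, hA, hA'⟩ := hφ.exists_wordDist_le hSf hS hS'
  obtain ⟨B, hB, hB'⟩ := hψ.exists_wordDist_le hSf' hS' hS
  obtain ⟨E, hE, hE'⟩ := hψφ.exists_finite
  obtain ⟨M, hM⟩ := (hE.image fun e => wordDist S 1 e).bddAbove
  have hM' : ∀ g, wordDist S (ψ (φ g)) g ≤ M := by
    intro g
    obtain ⟨e, he, h⟩ := hE' g
    have := hM ⟨e, he, rfl⟩
    simp only [Function.comp_apply, id] at h
    dsimp only at this
    rwa [← wordDist_mul_left hS (ψ (φ g)), mul_one, ← h] at this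
  have hM0 : 0 ≤ M := (wordDist_nonneg _ _ _).trans (hM' 1)
  refine ⟨A + B + 2 * M + 1, by linarith, fun g h => ⟨?_, ?_⟩⟩
  · nlinarith [hA' g h, wordDist_nonneg S g h]
  · have h1 := wordDist_triangle hS g (ψ (φ g)) h
    have h2 := wordDist_triangle hS (ψ (φ g)) (ψ (φ h)) h
    have h3 := hM' g
    have h4 := hM' h
    have h5 := hB' (φ g) (φ h)
    rw [wordDist_comm] at h3
    nlinarith [wordDist_nonneg S' (φ g) (φ h)]

theorem exists_finite_generators (hG : Group.FG G) :
    ∃ S : Set G, S.Finite ∧ Subgroup.closure S = ⊤ := by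
  obtain ⟨S, hS⟩ := hG.out
  exact ⟨S, S.finite_toSet, hS⟩

end Groups

/-! ### The four-point condition and slim triangles -/

section FourPoint

/-- Gromov's four-point condition: of the three sums of opposite distances of four points, the two
largest differ by at most `δ`. -/
def FourPoint (Y : Type u) [PseudoMetricSpace Y] (δ : ℝ) : Prop :=
  ∀ x y z w : Y, dist x y + dist z w ≤
    max (dist x z + dist y w) (dist x w + dist y z) + δ

/-- Up to the error `C`, there is a point at each prescribed distance between two given points. -/
def RoughlyGeodesic (Y : Type u) [PseudoMetricSpace Y] (C : ℝ) : Prop :=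
  ∀ x y : Y, ∀ r ∈ Set.Icc 0 (dist x y),
    ∃ z, dist x z ≤ r + C ∧ dist z y ≤ dist x y - r + C

/-- All geodesic triangles are `δ`-slim. -/
def SlimTriangles (X : Type u) [MetricSpace X] (δ : ℝ) : Prop :=
  ∀ (x y z : X) (α β γ : ℝ → X),
    IsGeodesic α x y → IsGeodesic β y z → IsGeodesic γ x z →
    ∀ t ∈ Set.Icc 0 (dist x z),
      (∃ s ∈ Set.Icc 0 (dist x y), dist (γ t) (α s) ≤ δ) ∨
      (∃ s ∈ Set.Icc 0 (dist y z), dist (γ t) (β s) ≤ δ)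

variable {X : Type u} [MetricSpace X]

theorem IsGeodesic.dist_left {γ : ℝ → X} {x y : X} (h : IsGeodesic γ x y) {t : ℝ}
    (ht : t ∈ Set.Icc 0 (dist x y)) : dist x (γ t) = t := by
  have := h.isometry 0 ⟨le_rfl, dist_nonneg⟩ t ht
  rw [h.source, zero_sub, abs_neg, abs_of_nonneg ht.1] at this
  exact this

theorem IsGeodesic.dist_right {γ : ℝ → X} {x y : X} (h : IsGeodesic γ x y) {t : ℝ}
    (ht : t ∈ Set.Icc 0 (dist x y)) : dist (γ t) y = dist x y - t := by
  have := h.isometry t ht _ ⟨dist_nonneg, le_rfl⟩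
  rw [h.target, abs_sub_comm, abs_of_nonneg (sub_nonneg.2 ht.2)] at this
  exact this

/-- On the side `γ` of a slim triangle, there is a point that is close to both other sides, hence
almost between their end points: the last point that is close to the first of them. -/
theorem SlimTriangles.exists_between {δ : ℝ} (hslim : SlimTriangles X δ) (hX : IsGeodesicSpace X)
    {x y : X} {γ : ℝ → X} (hγ : IsGeodesic γ x y) (z : X) :
    ∃ t ∈ Set.Icc 0 (dist x y), dist x (γ t) + dist (γ t) z ≤ dist x z + 2 * (|δ| + 1) ∧
      dist y (γ t) + dist (γ t) z ≤ dist y z + 2 * (|δ| + 1) := by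
  obtain ⟨α, hα⟩ := hX x z
  obtain ⟨β, hβ⟩ := hX z y
  have hδ : δ ≤ |δ| := le_abs_self δ
  have hδ0 : 0 ≤ |δ| := abs_nonneg δ
  set L := dist x y with hL
  have hL0 : 0 ≤ L := dist_nonneg
  set A : Set ℝ := {t | t ∈ Set.Icc 0 L ∧ ∃ s ∈ Set.Icc 0 (dist x z), dist (γ t) (α s) ≤ |δ|}
    with hA
  have h0A : (0 : ℝ) ∈ A :=
    ⟨⟨le_rfl, hL0⟩, 0, ⟨le_rfl, dist_nonneg⟩, by rw [hγ.source, hα.source, dist_self]; exact hδ0⟩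
  have hbdd : BddAbove A := ⟨L, fun t ht => ht.1.2⟩
  obtain ⟨a, ⟨haI, s, hs, has⟩, ha⟩ := exists_lt_of_lt_csSup ⟨0, h0A⟩ (sub_one_lt (sSup A))
  -- a point close to the other side, at distance at most one from `a`
  obtain ⟨b, hbI, hab, s', hs', hbs⟩ : ∃ b ∈ Set.Icc 0 L, |a - b| ≤ 1 ∧
      ∃ s ∈ Set.Icc 0 (dist z y), dist (γ b) (β s) ≤ |δ| := by
    by_cases hcase : a + 1 ≤ L
    · have hmem : a + 1 ∈ Set.Icc 0 L := ⟨by linarith [haI.1], hcase⟩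
      refine ⟨a + 1, hmem, by simp, ?_⟩
      rcases hslim x z y α β γ hα hβ hγ (a + 1) hmem with ⟨s, hs, h⟩ | ⟨s, hs, h⟩
      · have := le_csSup hbdd (show a + 1 ∈ A from ⟨hmem, s, hs, h.trans hδ⟩)
        linarith
      · exact ⟨s, hs, h.trans hδ⟩
    · refine ⟨L, ⟨hL0, le_rfl⟩, ?_, dist z y, ⟨dist_nonneg, le_rfl⟩, ?_⟩
      · rw [abs_le]; constructor <;> linarith [haI.2]
      · rw [hγ.target, hβ.target, dist_self]; exact hδ0
  refine ⟨a, haI, ?_, ?_⟩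
  · have h1 := hα.dist_left hs
    have h2 := hα.dist_right hs
    have h3 := dist_triangle x (α s) (γ a)
    have h4 := dist_triangle (γ a) (α s) z
    rw [dist_comm (α s)] at h3
    linarith
  · have h1 := hβ.dist_left hs'
    have h2 := hβ.dist_right hs'
    have h3 := dist_triangle4 y (β s') (γ b) (γ a)
    have h4 := dist_triangle4 (γ a) (γ b) (β s') z
    have h5 := hγ.isometry a haI b hbI
    linarith [dist_comm y z, dist_comm y (β s'), dist_comm z (β s'), dist_comm (β s') (γ b),
      dist_comm (γ a) (γ b)]

theorem SlimTriangles.fourPoint {δ : ℝ} (hslim : SlimTriangles X δ) (hX : IsGeodesicSpace X) :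
    FourPoint X (4 * (|δ| + 1)) := by
  intro x y z w
  obtain ⟨γ, hγ⟩ := hX x y
  obtain ⟨t, ht, h1, h2⟩ := hslim.exists_between hX hγ z
  obtain ⟨s, hs, h3, h4⟩ := hslim.exists_between hX hγ w
  have e1 := hγ.dist_left ht
  have e2 := hγ.dist_right ht
  have e3 := hγ.dist_left hs
  have e4 := hγ.dist_right hs
  have e5 := hγ.isometry t ht s hs
  have e6 := dist_triangle4 z (γ t) (γ s) w
  rw [dist_comm y] at h2 h4
  rw [dist_comm z (γ t)] at e6
  rcases le_total t s with h | h
  · rw [abs_sub_comm, abs_of_nonneg (sub_nonneg.2 h)] at e5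
    have := le_max_right (dist x z + dist y w) (dist x w + dist y z)
    linarith
  · rw [abs_of_nonneg (sub_nonneg.2 h)] at e5
    have := le_max_left (dist x z + dist y w) (dist x w + dist y z)
    linarith

/-- A point that is almost between the end points of a geodesic is close to it. -/
theorem FourPoint.exists_dist_geodesic_le {δ : ℝ} (hδ : 0 ≤ δ) (h4 : FourPoint X δ) {x y p : X}
    {α : ℝ → X} (hα : IsGeodesic α x y) (h : dist x p + dist p y ≤ dist x y + δ) :
    ∃ s ∈ Set.Icc 0 (dist x y), dist p (α s) ≤ 2 * δ := by
  by_cases hle : dist x p ≤ dist x y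
  · have hs : dist x p ∈ Set.Icc 0 (dist x y) := ⟨dist_nonneg, hle⟩
    refine ⟨_, hs, ?_⟩
    have h1 := h4 p (α (dist x p)) x y
    rw [hα.dist_right hs, dist_comm _ x, dist_comm _ x, hα.dist_left hs] at h1
    rcases max_choice (dist x p + (dist x y - dist x p)) (dist p y + dist x p) with h2 | h2 <;>
      rw [h2] at h1 <;> linarith
  · refine ⟨dist x y, ⟨dist_nonneg, le_rfl⟩, ?_⟩
    rw [hα.target]
    linarith

theorem FourPoint.slimTriangles {δ : ℝ} (hδ : 0 ≤ δ) (h4 : FourPoint X δ) :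
    SlimTriangles X (2 * δ) := by
  intro x y z α β γ hα hβ hγ t ht
  have e1 := hγ.dist_left ht
  have e2 := hγ.dist_right ht
  have h1 := h4 y (γ t) x z
  rw [dist_comm y x, dist_comm (γ t) x, dist_comm y (γ t)] at h1
  rcases max_choice (dist x y + dist (γ t) z) (dist y z + dist x (γ t)) with h2 | h2 <;>
    rw [h2] at h1
  · exact Or.inl (h4.exists_dist_geodesic_le hδ hα (by linarith))
  · exact Or.inr (h4.exists_dist_geodesic_le hδ hβ (by rw [dist_comm y]; linarith))

/-- The four-point condition can be pulled back along maps that preserve distances up to an additive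
error. -/
theorem FourPoint.of_dist_le {Y : Type u} {Z : Type v} [PseudoMetricSpace Y] [PseudoMetricSpace Z]
    {δ B : ℝ} (h4 : FourPoint Y δ) (f : Z → Y)
    (hf : ∀ a b, |dist (f a) (f b) - dist a b| ≤ B) : FourPoint Z (δ + 4 * B) := by
  intro x y z w
  have h := h4 (f x) (f y) (f z) (f w)
  have hf' : ∀ a b, dist (f a) (f b) ≤ dist a b + B ∧ dist a b ≤ dist (f a) (f b) + B := by
    intro a b
    have := abs_le.1 (hf a b)
    constructor <;> linarith
  have h1 := (hf' x y).2
  have h2 := (hf' z w).2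
  have h3 := (hf' x z).1
  have h4 := (hf' y w).1
  have h5 := (hf' x w).1
  have h6 := (hf' y z).1
  have h7 : max (dist (f x) (f z) + dist (f y) (f w)) (dist (f x) (f w) + dist (f y) (f z)) ≤
      max (dist x z + dist y w) (dist x w + dist y z) + 2 * B := by
    rw [← max_add_add_right]
    apply max_le_max <;> linarith
  linarith

end FourPoint

/-! ### The tight span -/

section TightSpan

/-- The functions `f` with `dist x y ≤ f x + f y`. They form a convex set of functions that contains
the distance functions `dist · z`. -/
def IsUpper {Y : Type u} [PseudoMetricSpace Y] (f : Y → ℝ) : Prop :=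
  ∀ x y, dist x y ≤ f x + f y

/-- The tight span (injective hull) of a pseudometric space `Y`: the functions `f` with
`dist x y ≤ f x + f y` that are pointwise minimal, i.e. for which `f x` is the supremum of
`dist x y - f y` over all `y`. The minimality is spelled out with `ε` in place of the supremum. -/
def TightSpan (Y : Type u) [PseudoMetricSpace Y] : Type u :=
  {f : Y → ℝ // IsUpper f ∧ ∀ x, ∀ ε > 0, ∃ y, f x + f y ≤ dist x y + ε}

variable {Y : Type u} [PseudoMetricSpace Y]

theorem IsUpper.nonneg {f : Y → ℝ} (hf : IsUpper f) (x : Y) : 0 ≤ f x := by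
  have := hf x x
  rw [dist_self] at this
  linarith

/-- The function `x ↦ sup_y (dist x y - f y)`; its fixed points are the points of the tight span. -/
noncomputable def upperConj (f : Y → ℝ) (x : Y) : ℝ := ⨆ y, (dist x y - f y)

/-- The average of a function and its conjugate. Iterating it retracts the functions that satisfy
`IsUpper` onto the tight span. -/
noncomputable def halfway (f : Y → ℝ) (x : Y) : ℝ := (f x + upperConj f x) / 2

theorem IsUpper.bddAbove {f : Y → ℝ} (hf : IsUpper f) (x : Y) :
    BddAbove (Set.range fun y => dist x y - f y) :=
  ⟨f x, by rintro _ ⟨y, rfl⟩; linarith [hf x y]⟩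

theorem IsUpper.le_upperConj {f : Y → ℝ} (hf : IsUpper f) (x y : Y) :
    dist x y - f y ≤ upperConj f x := le_ciSup (hf.bddAbove x) y

theorem IsUpper.upperConj_le {f : Y → ℝ} (hf : IsUpper f) (x : Y) : upperConj f x ≤ f x := by
  have : Nonempty Y := ⟨x⟩
  exact ciSup_le fun y => by linarith [hf x y]

theorem exists_upperConj_lt {f : Y → ℝ} (x : Y) {ε : ℝ} (hε : 0 < ε) :
    ∃ y, upperConj f x - ε < dist x y - f y := by
  have : Nonempty Y := ⟨x⟩
  exact exists_lt_of_lt_ciSup (sub_lt_self _ hε)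

theorem IsUpper.halfway {f : Y → ℝ} (hf : IsUpper f) : IsUpper (halfway f) := by
  intro x y
  have h1 := hf.le_upperConj x y
  have h2 := hf.le_upperConj y x
  rw [dist_comm y x] at h2
  simp only [CoarseGroup.halfway]
  linarith

theorem IsUpper.halfway_le {f : Y → ℝ} (hf : IsUpper f) (x : Y) :
    CoarseGroup.halfway f x ≤ f x := by
  have := hf.upperConj_le x
  simp only [CoarseGroup.halfway]
  linarith

theorem upperConj_le_add {f g : Y → ℝ} (hg : IsUpper g) {c : ℝ}
    (h : ∀ y, g y ≤ f y + c) (x : Y) : upperConj f x ≤ upperConj g x + c := by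
  have : Nonempty Y := ⟨x⟩
  exact ciSup_le fun y => by linarith [hg.le_upperConj x y, h y]

/-- The gap between a function and its conjugate is at least halved. -/
theorem IsUpper.halfway_sub_le {f : Y → ℝ} (hf : IsUpper f) (x : Y) :
    CoarseGroup.halfway f x - upperConj (CoarseGroup.halfway f) x ≤ (f x - upperConj f x) / 2 := by
  have := upperConj_le_add hf.halfway (f := f) (c := 0)
    (fun y => by linarith [hf.halfway_le y]) x
  have h2 : CoarseGroup.halfway f x = (f x + upperConj f x) / 2 := rfl
  linarith

theorem halfway_le_add {f g : Y → ℝ} (hf : IsUpper f) {c : ℝ}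
    (h : ∀ y, |f y - g y| ≤ c) (x : Y) : halfway g x ≤ halfway f x + c := by
  have h1 := upperConj_le_add hf (f := g) (c := c) (fun y => by linarith [(abs_le.1 (h y)).2]) x
  have h2 := (abs_le.1 (h x)).1
  simp only [halfway]
  linarith

theorem isUpper_iterate {f : Y → ℝ} (hf : IsUpper f) (n : ℕ) : IsUpper (halfway^[n] f) := by
  induction n with
  | zero => exact hf
  | succ n ih => rw [Function.iterate_succ_apply']; exact ih.halfway

theorem antitone_iterate {f : Y → ℝ} (hf : IsUpper f) (x : Y) :
    Antitone fun n => halfway^[n] f x := by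
  refine antitone_nat_of_succ_le fun n => ?_
  rw [Function.iterate_succ_apply']
  exact (isUpper_iterate hf n).halfway_le x

theorem tendsto_iterate {f : Y → ℝ} (hf : IsUpper f) (x : Y) :
    Filter.Tendsto (fun n => halfway^[n] f x) Filter.atTop (nhds (⨅ n, halfway^[n] f x)) :=
  tendsto_atTop_ciInf (antitone_iterate hf x)
    ⟨0, by rintro _ ⟨n, rfl⟩; exact (isUpper_iterate hf n).nonneg x⟩

theorem iterate_gap_le {f : Y → ℝ} (hf : IsUpper f) (n : ℕ) (x : Y) :
    halfway^[n] f x - upperConj (halfway^[n] f) x ≤ (f x - upperConj f x) * (1 / 2) ^ n := by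
  induction n with
  | zero => simp
  | succ n ih =>
    rw [Function.iterate_succ_apply', pow_succ]
    have := (isUpper_iterate hf n).halfway_sub_le x
    linarith

theorem abs_iterate_sub_le {f g : Y → ℝ} (hf : IsUpper f) (hg : IsUpper g) {c : ℝ}
    (h : ∀ y, |f y - g y| ≤ c) (n : ℕ) (x : Y) : |halfway^[n] f x - halfway^[n] g x| ≤ c := by
  induction n generalizing x with
  | zero => exact h x
  | succ n ih =>
    rw [Function.iterate_succ_apply', Function.iterate_succ_apply', abs_le]
    have h1 := halfway_le_add (isUpper_iterate hf n) ih x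
    have h2 := halfway_le_add (isUpper_iterate hg n) (fun y => by rw [abs_sub_comm]; exact ih y) x
    constructor <;> linarith

namespace TightSpan

instance : CoeFun (TightSpan Y) fun _ => Y → ℝ := ⟨Subtype.val⟩

theorem isUpper (f : TightSpan Y) : IsUpper (f : Y → ℝ) := f.2.1

theorem exists_add_le (f : TightSpan Y) (x : Y) {ε : ℝ} (hε : 0 < ε) :
    ∃ y, f x + f y ≤ dist x y + ε := f.2.2 x ε hε

theorem le_add_dist (f : TightSpan Y) (x y : Y) : f x ≤ f y + dist x y := by
  refine le_of_forall_pos_le_add fun ε hε => ?_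
  obtain ⟨z, hz⟩ := f.exists_add_le x hε
  linarith [f.isUpper y z, dist_triangle x y z]

/-- The `1`-Lipschitz retraction onto the tight span. -/
noncomputable def retract (f : Y → ℝ) (hf : IsUpper f) : TightSpan Y := by
  refine ⟨fun x => ⨅ n, halfway^[n] f x, fun x y => ?_, fun x ε hε => ?_⟩
  · exact ge_of_tendsto' ((tendsto_iterate hf x).add (tendsto_iterate hf y))
      fun n => isUpper_iterate hf n x y
  · have hlim : Filter.Tendsto (fun n : ℕ => (f x - upperConj f x) * (1 / 2 : ℝ) ^ n)
        Filter.atTop (nhds ((f x - upperConj f x) * 0)) :=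
      (tendsto_pow_atTop_nhds_zero_of_lt_one (by norm_num) (by norm_num)).const_mul _
    rw [mul_zero] at hlim
    obtain ⟨n, hn⟩ := (hlim.eventually_lt_const (half_pos hε)).exists
    obtain ⟨y, hy⟩ := exists_upperConj_lt (f := halfway^[n] f) x (half_pos hε)
    have h1 := (antitone_iterate hf x).le_of_tendsto (tendsto_iterate hf x) n
    have h2 := (antitone_iterate hf y).le_of_tendsto (tendsto_iterate hf y) n
    have h3 := iterate_gap_le hf n x
    exact ⟨y, by linarith⟩

theorem abs_retract_sub_le {f g : Y → ℝ} (hf : IsUpper f) (hg : IsUpper g) {c : ℝ}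
    (h : ∀ y, |f y - g y| ≤ c) (x : Y) : |retract f hf x - retract g hg x| ≤ c :=
  le_of_tendsto' ((tendsto_iterate hf x).sub (tendsto_iterate hg x)).abs
    fun n => abs_iterate_sub_le hf hg h n x

theorem upperConj_eq (f : TightSpan Y) : upperConj (f : Y → ℝ) = f := by
  funext x
  refine le_antisymm (f.isUpper.upperConj_le x) (le_of_forall_pos_le_add fun ε hε => ?_)
  obtain ⟨y, hy⟩ := f.exists_add_le x hε
  linarith [f.isUpper.le_upperConj x y]

theorem retract_eq (f : TightSpan Y) : retract (f : Y → ℝ) f.isUpper = f := by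
  have h : halfway (f : Y → ℝ) = f := by
    funext x
    rw [halfway, upperConj_eq]
    ring
  apply Subtype.ext
  funext x
  change ⨅ n, halfway^[n] (f : Y → ℝ) x = f x
  simp only [Function.iterate_fixed h]
  exact ciInf_const

theorem abs_sub_le_add (f g : TightSpan Y) (x y : Y) : |f x - g x| ≤ f y + g y := by
  have h1 := f.le_add_dist x y
  have h2 := g.le_add_dist x y
  have h3 := f.isUpper x y
  have h4 := g.isUpper x y
  rw [abs_le]
  constructor <;> linarith

theorem bddAbove_range (f g : TightSpan Y) : BddAbove (Set.range fun x => |f x - g x|) := by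
  rcases isEmpty_or_nonempty Y with h | ⟨⟨y⟩⟩
  · exact ⟨0, by rintro _ ⟨x, -⟩; exact h.elim x⟩
  · exact ⟨f y + g y, by rintro _ ⟨x, rfl⟩; exact f.abs_sub_le_add g x y⟩

noncomputable instance : Dist (TightSpan Y) := ⟨fun f g => ⨆ x, |f x - g x|⟩

theorem abs_sub_le_dist (f g : TightSpan Y) (x : Y) : |f x - g x| ≤ dist f g :=
  le_ciSup (bddAbove_range f g) x

theorem dist_le_of_forall {f g : TightSpan Y} {c : ℝ} (hc : 0 ≤ c) (h : ∀ x, |f x - g x| ≤ c) :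
    dist f g ≤ c := Real.iSup_le h hc

theorem dist_nonneg' (f g : TightSpan Y) : 0 ≤ dist f g :=
  Real.iSup_nonneg fun _ => abs_nonneg _

/-- The tight span carries the supremum metric. -/
noncomputable instance : MetricSpace (TightSpan Y) where
  dist_self f := le_antisymm (dist_le_of_forall le_rfl fun x => by simp) (dist_nonneg' f f)
  dist_comm f g := by
    change ⨆ x, |f x - g x| = ⨆ x, |g x - f x|
    simp only [abs_sub_comm]
  dist_triangle f g h := by
    refine dist_le_of_forall (add_nonneg (dist_nonneg' _ _) (dist_nonneg' _ _)) fun x => ?_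
    exact (abs_sub_le _ (g x) _).trans (add_le_add (abs_sub_le_dist f g x) (abs_sub_le_dist g h x))
  eq_of_dist_eq_zero {f g} h := by
    apply Subtype.ext
    funext x
    have := abs_sub_le_dist f g x
    rw [h] at this
    exact sub_eq_zero.1 (abs_nonpos_iff.1 this)

/-- The image of a segment in the convex set of functions satisfying `IsUpper` under the
`1`-Lipschitz retraction is a geodesic. -/
theorem isGeodesicSpace : IsGeodesicSpace (TightSpan Y) := by
  intro f g
  set L := dist f g with hL
  rcases (dist_nonneg : 0 ≤ dist f g).eq_or_lt with h0 | hpos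
  · refine ⟨fun _ => f, rfl, (dist_eq_zero.1 h0.symm), fun s hs t ht => ?_⟩
    rw [← h0] at hs ht
    simp [le_antisymm hs.2 hs.1, le_antisymm ht.2 ht.1]
  · rw [← hL] at hpos
    have hup : ∀ t ∈ Set.Icc 0 L, IsUpper fun x => f x + t / L * (g x - f x) := by
      intro t ht x y
      have h1 : 0 ≤ t / L := div_nonneg ht.1 hpos.le
      have h2 : t / L ≤ 1 := div_le_one_of_le₀ ht.2 hpos.le
      nlinarith [f.isUpper x y, g.isUpper x y]
    have hproj : ∀ t, max 0 (min t L) ∈ Set.Icc 0 L := fun t =>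
      ⟨le_max_left _ _, max_le hpos.le (min_le_right _ _)⟩
    have hprojeq : ∀ t ∈ Set.Icc 0 L, max 0 (min t L) = t := fun t ht => by
      rw [min_eq_left ht.2, max_eq_right ht.1]
    let γ : ℝ → TightSpan Y := fun t => retract _ (hup _ (hproj t))
    have hγ : ∀ t (ht : t ∈ Set.Icc 0 L), γ t = retract _ (hup t ht) := fun t ht => by
      simp only [γ, hprojeq t ht]
    have hlip : ∀ s ∈ Set.Icc 0 L, ∀ t ∈ Set.Icc 0 L, dist (γ s) (γ t) ≤ |s - t| := by
      intro s hs t ht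
      rw [hγ s hs, hγ t ht]
      refine dist_le_of_forall (abs_nonneg _) (abs_retract_sub_le _ _ fun x => ?_)
      have h1 := abs_sub_le_dist g f x
      rw [dist_comm, ← hL] at h1
      have h2 : f x + s / L * (g x - f x) - (f x + t / L * (g x - f x)) =
          (s - t) * ((g x - f x) / L) := by ring
      rw [h2, abs_mul, abs_div, abs_of_pos hpos]
      exact mul_le_of_le_one_right (abs_nonneg _) (div_le_one_of_le₀ h1 hpos.le)
    have h0L : (0 : ℝ) ∈ Set.Icc 0 L := ⟨le_rfl, hpos.le⟩
    have hLL : L ∈ Set.Icc 0 L := ⟨hpos.le, le_rfl⟩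
    have hs : γ 0 = f := by
      rw [hγ 0 h0L]
      convert retract_eq f using 2
      funext x
      simp
    have ht : γ L = g := by
      rw [hγ L hLL]
      convert retract_eq g using 2
      funext x
      rw [div_self hpos.ne']
      ring
    have hle : ∀ s ∈ Set.Icc 0 L, ∀ t ∈ Set.Icc 0 L, s ≤ t → dist (γ s) (γ t) = |s - t| := by
      intro s hsI t htI hst
      refine le_antisymm (hlip s hsI t htI) ?_
      have h1 := hlip 0 h0L s hsI
      have h2 := hlip t htI L hLL
      have h3 := dist_triangle4 (γ 0) (γ s) (γ t) (γ L)
      rw [zero_sub, abs_neg, abs_of_nonneg hsI.1] at h1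
      rw [abs_sub_comm, abs_of_nonneg (sub_nonneg.2 htI.2)] at h2
      have h4 : dist (γ 0) (γ L) = L := by rw [hs, ht]
      rw [abs_sub_comm, abs_of_nonneg (sub_nonneg.2 hst)]
      linarith
    refine ⟨γ, hs, ht, fun s hsI t htI => ?_⟩
    rcases le_total s t with h | h
    · exact hle s hsI t htI h
    · rw [dist_comm, abs_sub_comm]
      exact hle t htI s hsI h

/-- The canonical map of a space to its tight span. -/
def kuratowski (z : Y) : TightSpan Y :=
  ⟨fun x => dist x z, fun x y => dist_triangle_right x y z,
    fun x ε hε => ⟨z, by simpa using hε.le⟩⟩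

theorem dist_kuratowski_right (f : TightSpan Y) (z : Y) : dist f (kuratowski z) = f z := by
  refine le_antisymm (dist_le_of_forall (f.isUpper.nonneg z) fun x => ?_) ?_
  · change |f x - dist x z| ≤ f z
    rw [abs_le]
    constructor <;> linarith [f.isUpper x z, f.le_add_dist x z]
  · refine le_trans ?_ (abs_sub_le_dist f (kuratowski z) z)
    change f z ≤ |f z - dist z z|
    rw [dist_self, sub_zero]
    exact le_abs_self _

theorem dist_kuratowski (y z : Y) : dist (kuratowski y) (kuratowski z) = dist y z := by
  rw [dist_kuratowski_right, dist_comm y z]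
  rfl

/-- A roughly geodesic hyperbolic space is coarsely dense in its tight span: if `f` almost attains
`f x + f y = dist x y`, a point at distance `f x` from `x` on the way to `y` is close to `f`. -/
theorem exists_dist_kuratowski_le {δ C : ℝ} (h4 : FourPoint Y δ) (hC : RoughlyGeodesic Y C)
    [Nonempty Y] (f : TightSpan Y) : ∃ z, dist f (kuratowski z) ≤ C + δ + 2 := by
  obtain ⟨x⟩ := ‹Nonempty Y›
  obtain ⟨y, hy⟩ := f.exists_add_le x one_pos
  have hfx := f.isUpper.nonneg x
  have hfy := f.isUpper.nonneg y
  have hxy := f.isUpper x y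
  obtain ⟨z, hz1, hz2⟩ := hC x y (min (f x) (dist x y))
    ⟨le_min hfx dist_nonneg, min_le_right _ _⟩
  obtain ⟨w, hw⟩ := f.exists_add_le z one_pos
  refine ⟨z, ?_⟩
  rw [dist_kuratowski_right]
  have h := h4 z w x y
  have hzx : dist z x ≤ f x + C := by
    rw [dist_comm]; linarith [min_le_left (f x) (dist x y)]
  have hzy : dist z y ≤ f y + C := by
    rcases min_choice (f x) (dist x y) with h' | h' <;> rw [h'] at hz2 <;> linarith
  have hmax : max (dist z x + dist w y) (dist z y + dist w x) ≤ f x + f y + f w + C :=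
    max_le (by linarith [f.isUpper w y]) (by linarith [f.isUpper w x])
  linarith

variable {G : Type v} [Group G] [MulAction G Y] [IsIsometricSMul G Y]

/-- Isometric actions extend to the tight span. -/
instance : MulAction G (TightSpan Y) where
  smul g f := ⟨fun x => f (g⁻¹ • x),
    fun x y => by rw [← dist_smul g⁻¹]; exact f.isUpper _ _,
    fun x ε hε => by
      obtain ⟨y, hy⟩ := f.exists_add_le (g⁻¹ • x) hε
      refine ⟨g • y, ?_⟩
      change f (g⁻¹ • x) + f (g⁻¹ • g • y) ≤ dist x (g • y) + ε
      rw [← dist_smul g⁻¹ x, inv_smul_smul]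
      exact hy⟩
  one_smul f := Subtype.ext (funext fun x => by
    change f ((1 : G)⁻¹ • x) = f x
    rw [inv_one, one_smul])
  mul_smul g h f := Subtype.ext (funext fun x => by
    change f ((g * h)⁻¹ • x) = f (h⁻¹ • g⁻¹ • x)
    rw [mul_inv_rev, mul_smul])

theorem smul_kuratowski (g : G) (z : Y) : g • kuratowski z = kuratowski (g • z) :=
  Subtype.ext (funext fun x => by
    change dist (g⁻¹ • x) z = dist x (g • z)
    rw [← dist_smul g, smul_inv_smul])

instance : IsIsometricSMul G (TightSpan Y) where
  isometry_smul g := Isometry.of_dist_eq fun f f' => by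
    have key : ∀ (g : G) (f f' : TightSpan Y), dist (g • f) (g • f') ≤ dist f f' :=
      fun g f f' => dist_le_of_forall dist_nonneg fun x => abs_sub_le_dist f f' (g⁻¹ • x)
    refine le_antisymm (key g f f') ?_
    simpa using key g⁻¹ (g • f) (g • f')

/-- The tight span of a roughly geodesic four-point space is hyperbolic. -/
theorem isHyperbolicSpace {δ C : ℝ} (h4 : FourPoint Y δ) (hC : RoughlyGeodesic Y C)
    [Nonempty Y] : IsHyperbolicSpace (TightSpan Y) := by
  refine ⟨⟨kuratowski (Classical.arbitrary Y)⟩, isGeodesicSpace, ?_⟩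
  choose z hz using exists_dist_kuratowski_le h4 hC
  have h := h4.of_dist_le z (B := 2 * (C + δ + 2)) fun a b => by
    rw [← dist_kuratowski, abs_le]
    have h1 := dist_triangle4 (kuratowski (z a)) a b (kuratowski (z b))
    have h2 := dist_triangle4 a (kuratowski (z a)) (kuratowski (z b)) b
    rw [dist_comm (kuratowski (z b)) b] at h2
    rw [dist_comm (kuratowski (z a)) a] at h1
    constructor <;> linarith [hz a, hz b]
  refine ⟨2 * |δ + 4 * (2 * (C + δ + 2))|, FourPoint.slimTriangles (abs_nonneg _) ?_⟩
  intro x y z w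
  exact (h x y z w).trans (by gcongr; exact le_abs_self _)

end TightSpan

end TightSpan

/-! ### Coarse paths in trees -/

section ZeroHyperbolic

variable {T : Type u} [MetricSpace T]

/-- A geodesic side of a triangle in a `0`-hyperbolic space lies in the union of the others. -/
theorem FourPoint.between_or (h4 : FourPoint T 0) {a b q : T}
    (hq : dist a q + dist q b = dist a b) (c : T) :
    dist a q + dist q c = dist a c ∨ dist c q + dist q b = dist c b := by
  have h := h4 c q a b
  have h1 := dist_triangle a q c
  have h2 := dist_triangle c q b
  rw [dist_comm c q, dist_comm c a, dist_comm q a] at h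
  rw [dist_comm c q] at h2 ⊢
  rcases max_choice (dist a c + dist q b) (dist c b + dist a q) with h' | h' <;> rw [h'] at h
  · left; linarith
  · right; linarith

/-- A point on a geodesic of a `0`-hyperbolic space cannot be avoided by coarse paths: a chain of
steps of length at most `J` from `a` to `b` comes `J`-close to every point `q` between `a` and `b`.
While the chain is away from `q`, the Gromov product of its current point with `b`, based at `a`,
cannot exceed `dist a q`. -/
theorem FourPoint.exists_dist_le_of_chain (h4 : FourPoint T 0) {ι : Type v} {R : ι → ι → Prop}
    {u : ι → T} {J : ℝ} (hJ0 : 0 ≤ J) (hJ : ∀ k l, R k l → dist (u k) (u l) ≤ J) {i j : ι}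
    (hij : Relation.ReflTransGen R i j) {q : T}
    (hq : dist (u i) q + dist q (u j) = dist (u i) (u j)) : ∃ k, dist (u k) q ≤ J := by
  by_contra! hfar
  have key : dist (u i) (u j) + dist (u i) (u j) - dist (u j) (u j) ≤ 2 * dist (u i) q := by
    suffices h : ∀ k, Relation.ReflTransGen R i k →
        dist (u i) (u k) + dist (u i) (u j) - dist (u k) (u j) ≤ 2 * dist (u i) q from h j hij
    intro k hk
    induction hk with
    | refl => rw [dist_self]; linarith [dist_nonneg (x := u i) (y := q)]
    | @tail k l _ hkl ih =>
      by_contra! hlt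
      have hstep := hJ k l hkl
      have hk := hfar k
      have h1 := h4 (u k) q (u i) (u j)
      have h2 := h4 (u i) (u l) (u k) (u j)
      have h3 := dist_triangle (u i) (u l) (u j)
      have h4 := dist_triangle (u i) (u l) (u k)
      have h5 := dist_triangle (u i) (u k) (u l)
      rw [dist_comm (u k) (u i), dist_comm q (u i)] at h1
      rw [dist_comm (u l) (u k)] at h2 h4
      rcases max_choice (dist (u i) (u k) + dist (u l) (u j)) (dist (u i) (u j) + dist (u k) (u l))
        with h' | h' <;> rw [h'] at h2
      · linarith
      · rcases max_choice (dist (u i) (u k) + dist q (u j)) (dist (u k) (u j) + dist (u i) q)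
          with h' | h' <;> rw [h'] at h1 <;> linarith
  have := hfar j
  rw [dist_self] at key
  rw [dist_comm] at this
  linarith

/-- Three points of a `0`-hyperbolic geodesic space have a median. -/
theorem FourPoint.exists_median (h4 : FourPoint T 0) (hT : IsGeodesicSpace T) (a b p : T) :
    ∃ q, dist a q + dist q b = dist a b ∧ dist a q + dist q p = dist a p ∧
      dist p q + dist q b = dist p b := by
  obtain ⟨γ, hγ⟩ := hT a b
  have h1 := dist_triangle a p b
  have h2 := dist_triangle a b p
  have h3 := dist_triangle p a b
  rw [dist_comm b p] at h2
  rw [dist_comm p a] at h3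
  have ht : (dist a p + dist a b - dist p b) / 2 ∈ Set.Icc 0 (dist a b) :=
    ⟨by linarith, by linarith⟩
  have e1 := hγ.dist_left ht
  have e2 := hγ.dist_right ht
  set q := γ ((dist a p + dist a b - dist p b) / 2)
  have h := h4 p q a b
  have h5 := dist_triangle a q p
  have h6 := dist_triangle p q b
  rw [dist_comm p q, dist_comm p a, dist_comm q a] at h
  rw [dist_comm p q] at h6
  rcases max_choice (dist a p + dist q b) (dist p b + dist a q) with h' | h' <;> rw [h'] at h <;>
    exact ⟨q, by linarith, by linarith, by rw [dist_comm p q]; linarith⟩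

theorem reflTransGen_Icc {a b : ℝ} (hab : a ≤ b) :
    Relation.ReflTransGen (fun s t : Set.Icc a b => |(s : ℝ) - t| ≤ 1)
      ⟨a, le_rfl, hab⟩ ⟨b, hab, le_rfl⟩ := by
  have key : ∀ n : ℕ, Relation.ReflTransGen (fun s t : Set.Icc a b => |(s : ℝ) - t| ≤ 1)
      ⟨a, le_rfl, hab⟩ ⟨min (a + n) b, le_min (by simp) hab, min_le_right _ _⟩ := by
    intro n
    induction n with
    | zero => simp only [Nat.cast_zero, add_zero, min_eq_left hab]; exact .refl
    | succ n ih =>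
      refine ih.tail ?_
      push_cast
      refine (abs_min_sub_min_le_max _ _ _ _).trans (max_le ?_ (by simp))
      rw [abs_le]
      constructor <;> linarith
  obtain ⟨n, hn⟩ := exists_nat_ge (b - a)
  have h := key n
  simp only [min_eq_right (show b ≤ a + n by linarith)] at h
  exact h

end ZeroHyperbolic

section QuasiTree

variable {X : Type u} {T : Type v} [MetricSpace X] [MetricSpace T] {K C : ℝ} {f : X → T}

theorem IsQIEmbedding.dist_le (hf : IsQIEmbedding K C f) (x y : X) :
    dist x y ≤ K * (dist (f x) (f y) + C) := by
  have hK : 0 < K := one_pos.trans_le hf.one_le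
  have := hf.lower x y
  rw [sub_le_iff_le_add, inv_mul_le_iff₀ hK] at this
  exact this

/-- The image of a geodesic under a quasi-isometric embedding into a tree comes close to each point
between the images of its end points. -/
theorem IsQIEmbedding.exists_dist_le_of_between (hf : IsQIEmbedding K C f) (h4 : FourPoint T 0)
    {x y : X} {γ : ℝ → X} (hγ : IsGeodesic γ x y) {a b : ℝ} (ha : 0 ≤ a) (hab : a ≤ b)
    (hb : b ≤ dist x y) {q : T}
    (hq : dist (f (γ a)) q + dist q (f (γ b)) = dist (f (γ a)) (f (γ b))) :
    ∃ s ∈ Set.Icc a b, dist (f (γ s)) q ≤ K + C := by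
  have hK := hf.one_le
  have hC := hf.nonneg
  obtain ⟨s, hs⟩ := h4.exists_dist_le_of_chain (J := K + C) (by linarith)
    (u := fun s : Set.Icc a b => f (γ s)) (fun s t hst => by
      refine (hf.upper _ _).trans ?_
      rw [hγ.isometry s ⟨ha.trans s.2.1, s.2.2.trans hb⟩ t ⟨ha.trans t.2.1, t.2.2.trans hb⟩]
      nlinarith) (reflTransGen_Icc hab) hq
  exact ⟨s, s.2, hs⟩

/-- The Morse lemma for trees: the image of a geodesic stays close to the geodesic in the tree. Let
`q` be the projection of the image of `γ t` to the geodesic in the tree. The image of `γ` comes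
close to `q` both before and after the time `t`, hence at times close to `t`. -/
theorem IsQIEmbedding.exists_between_dist_le (hf : IsQIEmbedding K C f) (h4 : FourPoint T 0)
    (hT : IsGeodesicSpace T) {x y : X} {γ : ℝ → X} (hγ : IsGeodesic γ x y) {t : ℝ}
    (ht : t ∈ Set.Icc 0 (dist x y)) :
    ∃ q, dist (f x) q + dist q (f y) = dist (f x) (f y) ∧
      dist (f (γ t)) q ≤ K * (K * (2 * (K + C) + C)) + 2 * C + K := by
  obtain ⟨q, hq, hq1, hq2⟩ := h4.exists_median hT (f x) (f y) (f (γ t))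
  refine ⟨q, hq, ?_⟩
  obtain ⟨s₁, hs₁, h₁⟩ := hf.exists_dist_le_of_between h4 hγ le_rfl ht.1 ht.2
    (by rw [hγ.source]; exact hq1)
  obtain ⟨s₂, hs₂, h₂⟩ := hf.exists_dist_le_of_between h4 hγ ht.1 ht.2 le_rfl
    (by rw [hγ.target]; exact hq2)
  have hs₁' : s₁ ∈ Set.Icc 0 (dist x y) := ⟨hs₁.1, hs₁.2.trans ht.2⟩
  have hs₂' : s₂ ∈ Set.Icc 0 (dist x y) := ⟨ht.1.trans hs₂.1, hs₂.2⟩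
  have e1 := hf.dist_le (γ s₁) (γ s₂)
  have e2 := hf.upper (γ t) (γ s₁)
  rw [hγ.isometry _ hs₁' _ hs₂', abs_sub_comm, abs_of_nonneg (by linarith [hs₁.2, hs₂.1])] at e1
  rw [hγ.isometry _ ht _ hs₁', abs_of_nonneg (by linarith [hs₁.2])] at e2
  have hK : 0 ≤ K := zero_le_one.trans hf.one_le
  have e3 : t - s₁ ≤ K * (2 * (K + C) + C) :=
    calc t - s₁ ≤ s₂ - s₁ := by linarith [hs₂.1]
      _ ≤ K * (dist (f (γ s₁)) (f (γ s₂)) + C) := e1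
      _ ≤ K * (2 * (K + C) + C) := by
        gcongr
        linarith [dist_triangle_right (f (γ s₁)) (f (γ s₂)) q]
  have e4 := mul_le_mul_of_nonneg_left e3 hK
  linarith [dist_triangle (f (γ t)) (f (γ s₁)) q]

/-- A geodesic space that embeds quasi-isometrically into a tree is hyperbolic. -/
theorem IsQIEmbedding.exists_slimTriangles (hf : IsQIEmbedding K C f) (h4 : FourPoint T 0)
    (hT : IsGeodesicSpace T) : ∃ δ, SlimTriangles X δ := by
  set M := K * (K * (2 * (K + C) + C)) + 2 * C + K with hM
  have hK : 0 ≤ K := zero_le_one.trans hf.one_le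
  have hle : ∀ {p p' : X} {q : T}, dist (f p) q ≤ M → dist (f p') q ≤ K + C →
      dist p p' ≤ K * (M + (K + C) + C) := by
    intro p p' q h h'
    refine (hf.dist_le p p').trans ?_
    gcongr
    exact (dist_triangle_right _ _ q).trans (add_le_add h h')
  refine ⟨K * (M + (K + C) + C), ?_⟩
  intro x y z α β γ hα hβ hγ t ht
  obtain ⟨q, hq, hq'⟩ := hf.exists_between_dist_le h4 hT hγ ht
  rcases h4.between_or hq (f y) with h | h
  · obtain ⟨s, hs, h'⟩ := hf.exists_dist_le_of_between h4 hα le_rfl dist_nonneg le_rfl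
      (by rw [hα.source, hα.target]; exact h)
    exact Or.inl ⟨s, hs, hle hq' h'⟩
  · obtain ⟨s, hs, h'⟩ := hf.exists_dist_le_of_between h4 hβ le_rfl dist_nonneg le_rfl
      (by rw [hβ.source, hβ.target]; exact h)
    exact Or.inr ⟨s, hs, hle hq' h'⟩

/-- Coarsely connected subsets of quasi-trees are quasi-convex. -/
theorem IsQIEmbedding.exists_dist_geodesic_le (hf : IsQIEmbedding K C f) (h4 : FourPoint T 0)
    (hT : IsGeodesicSpace T) {ι : Type w} {R : ι → ι → Prop} {F : ι → X} {B : ℝ}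
    (hR : ∀ i j, Relation.ReflTransGen R i j) (hB : ∀ i j, R i j → dist (F i) (F j) ≤ B) :
    ∃ M, ∀ i j (γ : ℝ → X), IsGeodesic γ (F i) (F j) → ∀ t ∈ Set.Icc 0 (dist (F i) (F j)),
      ∃ k, dist (γ t) (F k) ≤ M := by
  set M := K * (K * (2 * (K + C) + C)) + 2 * C + K with hM
  have hK : 0 ≤ K := zero_le_one.trans hf.one_le
  have hC := hf.nonneg
  refine ⟨K * (M + (K * |B| + C) + C), fun i j γ hγ t ht => ?_⟩
  obtain ⟨q, hq, hq'⟩ := hf.exists_between_dist_le h4 hT hγ ht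
  obtain ⟨k, hk⟩ := h4.exists_dist_le_of_chain (u := fun i => f (F i)) (J := K * |B| + C)
    (by positivity) (fun k l hkl => (hf.upper _ _).trans (by
      gcongr
      exact (hB k l hkl).trans (le_abs_self B))) (hR i j) hq
  refine ⟨k, (hf.dist_le _ _).trans ?_⟩
  gcongr
  exact (dist_triangle_right _ _ q).trans (add_le_add hq' hk)

end QuasiTree

/-! ### Subtrees spanned by coarsely connected sets -/

section Subtree

variable {T : Type u} [MetricSpace T]

/-- The union of the geodesics from `a` to the points `b i`. In a tree, it is the subtree spanned by
these points. -/
def starHull {ι : Type v} (a : T) (b : ι → T) : Set T :=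
  {p | ∃ i, dist a p + dist p (b i) = dist a (b i)}

theorem mem_starHull_of_between {ι : Type v} {a : T} {b : ι → T} (h4 : FourPoint T 0) {p p' m : T}
    (hp : p ∈ starHull a b) (hp' : p' ∈ starHull a b) (hm : dist p m + dist m p' = dist p p') :
    m ∈ starHull a b := by
  obtain ⟨i, hi⟩ := hp
  obtain ⟨j, hj⟩ := hp'
  rcases h4.between_or hm a with h | h
  · refine ⟨i, le_antisymm ?_ (dist_triangle _ _ _)⟩
    linarith [dist_comm p m, dist_comm m a, dist_comm p a, dist_triangle m p (b i)]
  · refine ⟨j, le_antisymm ?_ (dist_triangle _ _ _)⟩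
    linarith [dist_triangle m p' (b j)]

/-- If an interior point of an edge `v w` lies between the vertices `a` and `b`, so do `v` and
`w`. -/
theorem edge_between {V : Set T} {G : SimpleGraph V} (hG : G.IsTree)
    (hd : ∀ v w : V, dist (v : T) (w : T) = (G.dist v w : ℝ)) {a b v w : V} {p : T}
    (hvw : G.Adj v w) (hp : dist (v : T) p + dist p w = dist (v : T) w)
    (hpv : p ≠ v) (hpw : p ≠ w) (hab : dist (a : T) p + dist p b = dist (a : T) b) :
    dist (a : T) v + dist (v : T) b = dist (a : T) b ∧
      dist (a : T) w + dist (w : T) b = dist (a : T) b := by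
  have h1 : dist (v : T) w = 1 := by
    rw [hd, SimpleGraph.dist_eq_one_iff_adj.2 hvw, Nat.cast_one]
  have hstep : ∀ c : V, dist (c : T) v = dist (c : T) w + 1 ∨ dist (c : T) w = dist (c : T) v + 1 :=
    fun c => by
      simp only [hd]
      exact_mod_cast hG.isAcyclic.dist_eq_dist_add_one_of_adj_of_reachable c hvw (hG.connected c v)
  have hpv' : 0 < dist p v := dist_pos.2 hpv
  have hpw' : 0 < dist p w := dist_pos.2 hpw
  have t1 := dist_triangle (a : T) p v
  have t2 := dist_triangle (a : T) p w
  have t3 := dist_triangle (b : T) p v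
  have t4 := dist_triangle (b : T) p w
  have t5 := dist_triangle (a : T) v b
  have t6 := dist_triangle (a : T) w b
  have c1 := dist_comm (v : T) p
  have c2 := dist_comm (b : T) p
  have c3 := dist_comm (b : T) v
  have c4 := dist_comm (b : T) w
  rcases hstep a with ha | ha <;> rcases hstep b with hb | hb <;> constructor <;> linarith

/-- Shortest walks between vertices of a convex set of vertices, here the range of `g`, run inside
this set. -/
theorem exists_walk_comap {V W : Type*} {G : SimpleGraph V} (g : W → V)
    (hconv : ∀ v w : W, ∀ m : V, G.dist (g v) m + G.dist m (g w) = G.dist (g v) (g w) →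
      ∃ m', g m' = m) (hinj : Function.Injective g) (hG : G.Connected) (n : ℕ) (v w : W)
    (h : G.dist (g v) (g w) = n) : ∃ p : (G.comap g).Walk v w, p.length = n := by
  induction n generalizing v with
  | zero =>
    obtain rfl : v = w := hinj ((hG.dist_eq_zero_iff).1 h)
    exact ⟨.nil, rfl⟩
  | succ n ih =>
    have hcons : ∀ a b, ∀ p : G.Walk a b, p.length = n + 1 →
        ∃ m, G.Adj a m ∧ ∃ q : G.Walk m b, q.length = n := by
      rintro a b (_ | ⟨hadj, q⟩) hp
      · simp at hp
      · exact ⟨_, hadj, q, by simpa using hp⟩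
    obtain ⟨p, hp⟩ := hG.exists_walk_length_eq_dist (g v) (g w)
    obtain ⟨m, hadj, q, hq⟩ := hcons _ _ p (hp.trans h)
    have h1 : G.dist (g v) m = 1 := SimpleGraph.dist_eq_one_iff_adj.2 hadj
    have h2 := SimpleGraph.dist_le q
    have h3 := hG.dist_triangle (u := g v) (v := m) (w := g w)
    obtain ⟨m', rfl⟩ := hconv v w m (by omega)
    obtain ⟨p', hp'⟩ := ih m' (by omega)
    have hadj' : (G.comap g).Adj v m' := hadj
    exact ⟨.cons hadj' p', by rw [SimpleGraph.Walk.length_cons, hp']⟩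

/-- The union of the geodesics between a vertex and a family of vertices is a tree. -/
theorem isMetricTree_starHull {ι : Type v} (hT : IsGeodesicSpace T) (h4 : FourPoint T 0)
    {V : Set T} {G : SimpleGraph V} (hG : G.IsTree)
    (hd : ∀ v w : V, dist (v : T) (w : T) = (G.dist v w : ℝ))
    (hedge : ∀ x : T, ∃ v w : V, dist (v : T) w ≤ 1 ∧ dist (v : T) x + dist x w = dist (v : T) w)
    (a : V) (b : ι → V) [Nonempty ι] : IsMetricTree (starHull (a : T) fun i => (b i : T)) := by
  set A := starHull (a : T) fun i => (b i : T) with hA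
  refine ⟨?_, fun x y z w => (h4 (x : T) y z w).trans_eq (add_zero _), ?_⟩
  · intro x y
    obtain ⟨γ, hγ⟩ := hT (x : T) y
    have hmem : ∀ t ∈ Set.Icc 0 (dist (x : T) y), γ t ∈ A := fun t ht =>
      mem_starHull_of_between h4 x.2 y.2 (by rw [hγ.dist_left ht, hγ.dist_right ht]; ring)
    classical
    refine ⟨fun t => if ht : t ∈ Set.Icc 0 (dist (x : T) y) then ⟨γ t, hmem t ht⟩ else x,
      ?_, ?_, ?_⟩
    · have h0 : (0 : ℝ) ∈ Set.Icc 0 (dist (x : T) y) := ⟨le_rfl, dist_nonneg⟩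
      rw [dif_pos h0]
      exact Subtype.ext hγ.source
    · have hL : dist x y ∈ Set.Icc 0 (dist (x : T) y) := ⟨dist_nonneg, le_rfl⟩
      rw [dif_pos hL]
      exact Subtype.ext hγ.target
    · intro s hs t ht
      have hs' : s ∈ Set.Icc 0 (dist (x : T) y) := hs
      have ht' : t ∈ Set.Icc 0 (dist (x : T) y) := ht
      rw [dif_pos hs', dif_pos ht']
      exact hγ.isometry s hs t ht
  · let g : {p : A | (p : T) ∈ V} → V := fun v => ⟨v.1.1, v.2⟩
    have hginj : Function.Injective g := fun v w h => by
      apply Subtype.ext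
      apply Subtype.ext
      exact congrArg (fun z : V => (z : T)) h
    have hmem : ∀ m : V, (m : T) ∈ A → ∃ m', g m' = m := fun m hm => ⟨⟨⟨m, hm⟩, m.2⟩, rfl⟩
    have hconv : ∀ v w, ∀ m : V, G.dist (g v) m + G.dist m (g w) = G.dist (g v) (g w) →
        ∃ m', g m' = m := fun v w m hm => hmem m (mem_starHull_of_between h4 v.1.2 w.1.2 (by
      change dist (g v : T) m + dist (m : T) (g w) = dist (g v : T) (g w)
      rw [hd, hd, hd]
      exact_mod_cast hm))
    have hwalk := fun v w => exists_walk_comap g hconv hginj hG.connected _ v w rfl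
    refine ⟨{p : A | (p : T) ∈ V}, G.comap g, ⟨?_, ?_⟩, ?_, ?_⟩
    · have ha : (a : T) ∈ A := ⟨Classical.arbitrary ι, by simp⟩
      have : Nonempty {p : A | (p : T) ∈ V} := ⟨⟨⟨a, ha⟩, a.2⟩⟩
      exact ⟨fun v w => ⟨(hwalk v w).choose⟩⟩
    · exact hG.isAcyclic.comap ⟨g, fun h => h⟩ hginj
    · intro v w
      change dist (g v : T) (g w) = _
      rw [hd, Nat.cast_inj]
      obtain ⟨p, hp⟩ := hwalk v w
      refine le_antisymm ?_ (hp ▸ SimpleGraph.dist_le p)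
      obtain ⟨p', hp'⟩ := SimpleGraph.Reachable.exists_walk_length_eq_dist ⟨p⟩
      let hom : G.comap g →g G := ⟨g, fun h => h⟩
      rw [← hp', ← SimpleGraph.Walk.length_map hom]
      exact SimpleGraph.dist_le _
    · intro p
      by_cases hpV : (p : T) ∈ V
      · exact ⟨⟨p, hpV⟩, ⟨p, hpV⟩, by simp, by simp⟩
      obtain ⟨v, w, hvw, hp⟩ := hedge p
      have hpv : (p : T) ≠ v := fun h => hpV (h ▸ v.2)
      have hpw : (p : T) ≠ w := fun h => hpV (h ▸ w.2)
      have hadj : G.Adj v w := by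
        rw [← SimpleGraph.dist_eq_one_iff_adj]
        have h0 : 0 < dist (v : T) w := by
          linarith [dist_pos.2 hpv.symm, dist_nonneg (x := (p : T)) (y := w)]
        rw [hd] at hvw h0
        have h1 : G.dist v w ≤ 1 := by exact_mod_cast hvw
        have h2 : 0 < G.dist v w := by exact_mod_cast h0
        omega
      obtain ⟨i, hi⟩ := p.2
      obtain ⟨hv, hw⟩ := edge_between hG hd hadj hp hpv hpw hi
      exact ⟨⟨⟨v, i, hv⟩, v.2⟩, ⟨⟨w, i, hw⟩, w.2⟩, hvw, hp⟩

/-- A coarsely connected subset of a tree is close to a subtree. -/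
theorem IsMetricTree.exists_subtree (hT : IsMetricTree T) {ι : Type v} [Nonempty ι]
    {R : ι → ι → Prop} {F : ι → T} {J : ℝ} (hR : ∀ i j, Relation.ReflTransGen R i j)
    (hJ : ∀ i j, R i j → dist (F i) (F j) ≤ J) :
    ∃ A : Set T, IsMetricTree A ∧ ∃ b : ι → A, (∀ i, dist (F i) (b i) ≤ 1) ∧
      ∃ M, 0 ≤ M ∧ ∀ p, ∃ i, dist p (b i) ≤ M := by
  obtain ⟨hgeo, h4, V, G, hG, hd, hedge⟩ := hT
  have h4 : FourPoint T 0 := fun x y z w => by simpa using h4 x y z w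
  have hnear : ∀ x : T, ∃ v : V, dist x v ≤ 1 := fun x => by
    obtain ⟨v, w, h1, h2⟩ := hedge x
    exact ⟨v, by rw [dist_comm]; linarith [dist_nonneg (x := x) (y := (w : T))]⟩
  choose c hc using fun i => hnear (F i)
  obtain ⟨i₀⟩ := ‹Nonempty ι›
  have : Nonempty ι := ⟨i₀⟩
  refine ⟨starHull (c i₀ : T) fun i => (c i : T), isMetricTree_starHull hgeo h4 hG hd hedge _ _,
    fun i => ⟨c i, i, by simp⟩, hc, |J| + 2, by positivity, fun p => ?_⟩
  obtain ⟨i, hi⟩ := p.2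
  have hstep : ∀ k l, R k l → dist (c k : T) (c l) ≤ |J| + 2 := fun k l hkl => by
    have h1 := dist_triangle4 (c k : T) (F k) (F l) (c l)
    have h2 := hc k
    rw [dist_comm] at h2
    linarith [hc l, hJ k l hkl, le_abs_self J]
  obtain ⟨k, hk⟩ := h4.exists_dist_le_of_chain (u := fun i => (c i : T)) (by positivity) hstep
    (hR i₀ i) hi
  exact ⟨k, by rw [dist_comm]; exact hk⟩

end Subtree

/-! ### Pulling back quasi-actions along quasi-homomorphisms -/

section Pullback

variable {G : Type u} {H : Type v} [Group G] [Group H] {X : Type w} [MetricSpace X] {K C : ℝ}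

/-- A map `F` from a group to a metric space is coarsely left-invariant if left translations of the
group change the distance of values of `F` at most by the factor `K` and the summand `B`. -/
def CoarselyInvariant (K B : ℝ) (F : G → X) : Prop :=
  ∀ k g h, dist (F (k * g)) (F (k * h)) ≤ K * dist (F g) (F h) + B

theorem exists_bound_of_finite {A : Type*} {S : Set A} (hS : S.Finite) (f : A → ℝ) :
    ∃ M, 0 ≤ M ∧ ∀ a ∈ S, f a ≤ M := by
  obtain ⟨M, hM⟩ := (hS.image f).bddAbove
  exact ⟨max M 0, le_max_right _ _, fun a ha => (hM ⟨a, ha, rfl⟩).trans (le_max_left _ _)⟩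

theorem IsQuasiAction.dist_mul_le {ρ : H → X → X} (hρ : IsQuasiAction K C ρ) (h d : H) (x : X) :
    dist (ρ (h * d) x) (ρ h x) ≤ K * dist (ρ d x) x + 2 * C := by
  have h1 := hρ.comp h d x
  have h2 := (hρ.quasiIsometry h).upper (ρ d x) x
  rw [dist_comm] at h1
  linarith [dist_triangle (ρ (h * d) x) (ρ h (ρ d x)) (ρ h x)]

/-- The composition of a quasi-homomorphism with an orbit map is coarsely left-invariant. The
defects, which stand on the right of the formula `φ (x * y) = φ x * φ y * d`, only have to move the
base point by a bounded amount. -/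
theorem IsQuasiAction.exists_coarselyInvariant {ρ : H → X → X} (hρ : IsQuasiAction K C ρ)
    {φ : G → H} (hφ : IsQuasiHom φ) (x : X) :
    ∃ B, 0 ≤ B ∧ CoarselyInvariant K B fun g => ρ (φ g) x := by
  obtain ⟨D, hD, hdef⟩ := hφ.exists_defect
  obtain ⟨M, hM, hM'⟩ := exists_bound_of_finite hD fun d => dist (ρ d x) x
  have hK : 0 ≤ K := zero_le_one.trans (hρ.quasiIsometry 1).one_le
  have hC : 0 ≤ C := (hρ.quasiIsometry 1).nonneg
  have key : ∀ k g, dist (ρ (φ (k * g)) x) (ρ (φ k) (ρ (φ g) x)) ≤ K * M + 3 * C := by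
    intro k g
    obtain ⟨d, hd, h⟩ := hdef k g
    rw [h]
    have h1 := hρ.dist_mul_le (φ k * φ g) d x
    have h2 := hρ.comp (φ k) (φ g) x
    have h3 := mul_le_mul_of_nonneg_left (hM' d hd) hK
    linarith [dist_triangle_right (ρ (φ k * φ g * d) x) (ρ (φ k) (ρ (φ g) x)) (ρ (φ k * φ g) x)]
  refine ⟨2 * (K * M + 3 * C) + C, by positivity, fun k g h => ?_⟩
  have h1 := (hρ.quasiIsometry (φ k)).upper (ρ (φ g) x) (ρ (φ h) x)
  have h2 := dist_triangle4_right (ρ (φ (k * g)) x) (ρ (φ (k * h)) x)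
    (ρ (φ k) (ρ (φ g) x)) (ρ (φ k) (ρ (φ h) x))
  linarith [key k g, key k h]

theorem CoarselyInvariant.exists_step_le {B : ℝ} {F : G → X} (hF : CoarselyInvariant K B F)
    (hK : 0 ≤ K) {S : Set G} (hS : S.Finite) :
    ∃ J, ∀ a b, (∃ s ∈ S, b = a * s ∨ b = a * s⁻¹) → dist (F a) (F b) ≤ J := by
  obtain ⟨M, hM, hM'⟩ := exists_bound_of_finite hS fun s => dist (F 1) (F s)
  have key : ∀ a, ∀ s ∈ S, dist (F a) (F (a * s)) ≤ K * M + B := by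
    intro a s hs
    have h1 := hF a 1 s
    rw [mul_one] at h1
    linarith [mul_le_mul_of_nonneg_left (hM' s hs) hK]
  refine ⟨K * M + B, ?_⟩
  rintro a _ ⟨s, hs, rfl | rfl⟩
  · exact key a s hs
  · have := key (a * s⁻¹) s hs
    rwa [inv_mul_cancel_right, dist_comm] at this

theorem isQuasiAction_smul [MulAction H X] [IsIsometricSMul H X] :
    IsQuasiAction 1 0 fun (h : H) (x : X) => h • x where
  quasiIsometry h :=
    { one_le := le_rfl
      nonneg := le_rfl
      lower := fun x y => by simp
      upper := fun x y => by simp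
      coarse_onto := fun y => ⟨h⁻¹ • y, by simp⟩ }
  comp g h x := by simp [mul_smul]

/-- A group quasi-acts on every space with a coarsely dense and coarsely left-invariant map from the
group: move `p` by `g` by moving a group element whose value is close to `p`. -/
theorem CoarselyInvariant.exists_isQuasiAction {B M : ℝ} {F : G → X}
    (hF : CoarselyInvariant K B F) (hK : 1 ≤ K) (hM : ∀ p, ∃ g, dist p (F g) ≤ M) (hB : 0 ≤ B) :
    ∃ (C : ℝ) (ρ : G → X → X), IsQuasiAction K C ρ ∧
      ∀ x, Set.range (fun g => ρ g x) = Set.range F := by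
  choose c hc using hM
  have hM0 : 0 ≤ M := dist_nonneg.trans (hc (F 1))
  have hK0 : 0 < K := one_pos.trans_le hK
  have hKM : M ≤ K * M := le_mul_of_one_le_left hM0 hK
  refine ⟨K * (2 * M) + B, fun g p => F (g * c p), ⟨fun g => ?_, fun g h x => ?_⟩, fun x => ?_⟩
  · refine ⟨⟨hK, by positivity, fun x y => ?_, fun x y => ?_⟩, fun y => ?_⟩
    · have h1 := hF g⁻¹ (g * c x) (g * c y)
      rw [inv_mul_cancel_left, inv_mul_cancel_left] at h1
      rw [sub_le_iff_le_add, inv_mul_le_iff₀ hK0]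
      have h2 := dist_triangle4_right x y (F (c x)) (F (c y))
      have h3 : B + 2 * M ≤ K * (K * (2 * M) + B) := by nlinarith
      linarith [hc x, hc y]
    · have h1 := hF g (c x) (c y)
      have h2 := dist_triangle4 (F (c x)) x y (F (c y))
      rw [dist_comm _ x] at h2
      have h3 : dist (F (c x)) (F (c y)) ≤ dist x y + 2 * M := by linarith [hc x, hc y]
      linarith [mul_le_mul_of_nonneg_left h3 hK0.le]
    · refine ⟨F (g⁻¹ * c y), ?_⟩
      have h1 := hF g (g⁻¹ * c y) (c (F (g⁻¹ * c y)))
      rw [mul_inv_cancel_left] at h1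
      have h2 := mul_le_mul_of_nonneg_left (hc (F (g⁻¹ * c y))) hK0.le
      linarith [hc y, dist_triangle y (F (c y)) (F (g * c (F (g⁻¹ * c y))))]
  · have h1 := hF g (c (F (h * c x))) (h * c x)
    have h2 := mul_le_mul_of_nonneg_left (hc (F (h * c x))) hK0.le
    rw [dist_comm (F (c (F (h * c x)))), ← mul_assoc] at h1
    linarith
  · exact (Equiv.mulRight (c x)).surjective.range_comp F

end Pullback

/-! ### Property (QFA) -/

theorem PropertyQFA.of_quasiIsomorphism {G H : Type u} [Group G] [Group H] {φ : G → H}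
    (hφ : IsQuasiIsomorphism φ) (hG : Group.FG G) (h : PropertyQFA G) : PropertyQFA H := by
  intro X _ hX K C ρ hρ
  have hK := (hρ.quasiIsometry 1).one_le
  have hK0 : 0 ≤ K := zero_le_one.trans hK
  obtain ⟨x⟩ : Nonempty X := by
    obtain ⟨-, -, V, T, hT, -⟩ := hX
    exact hT.connected.nonempty.map Subtype.val
  obtain ⟨B, hB, hF⟩ := hρ.exists_coarselyInvariant hφ.1 x
  obtain ⟨S, hSf, hS⟩ := exists_finite_generators hG
  obtain ⟨J, hJ⟩ := hF.exists_step_le hK0 hSf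
  obtain ⟨A, hA, b, hb, M, -, hM⟩ :=
    hX.exists_subtree (reflTransGen_of_closure_eq_top hS) hJ
  have hbinv : CoarselyInvariant K (2 + K * 2 + B) b := by
    intro k g h
    have h1 := hF k g h
    have h2 := dist_triangle4 (b (k * g) : X) (ρ (φ (k * g)) x) (ρ (φ (k * h)) x) (b (k * h))
    have h3 := dist_triangle4 (ρ (φ g) x) (b g : X) (b h) (ρ (φ h) x)
    have h4 : dist (ρ (φ g) x) (ρ (φ h) x) ≤ dist (b g : X) (b h) + 2 := by
      rw [dist_comm (b h : X)] at h3
      linarith [hb g, hb h]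
    have h5 := mul_le_mul_of_nonneg_left h4 hK0
    rw [dist_comm (b (k * g) : X) (ρ (φ (k * g)) x)] at h2
    change dist (b (k * g) : X) (b (k * h)) ≤ K * dist (b g : X) (b h) + _
    linarith [hb (k * g), hb (k * h)]
  obtain ⟨C', ρ', hρ', hrange⟩ := hbinv.exists_isQuasiAction hK hM (by positivity)
  obtain ⟨p, hp⟩ := h A hA K C' ρ' hρ'
  rw [hrange, Metric.isBounded_iff] at hp
  obtain ⟨L, hL⟩ := hp
  obtain ⟨E, hE, hE'⟩ := hφ.exists_coarse_onto
  obtain ⟨N, hN, hN'⟩ := exists_bound_of_finite hE fun e => dist (ρ e x) x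
  have hclose : ∀ h, ∃ g, dist (ρ h x) (b g : X) ≤ K * N + 2 * C + 1 := by
    intro h
    obtain ⟨g, e, he, rfl⟩ := hE' h
    refine ⟨g, ?_⟩
    have h1 := hρ.dist_mul_le (φ g) e x
    have h2 := mul_le_mul_of_nonneg_left (hN' e he) hK0
    linarith [dist_triangle (ρ (φ g * e) x) (ρ (φ g) x) (b g), hb g]
  refine ⟨x, Metric.isBounded_iff.2 ⟨2 * (K * N + 2 * C + 1) + L, ?_⟩⟩
  rintro _ ⟨h₁, rfl⟩ _ ⟨h₂, rfl⟩
  obtain ⟨g₁, hg₁⟩ := hclose h₁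
  obtain ⟨g₂, hg₂⟩ := hclose h₂
  have h1 : dist (b g₁ : X) (b g₂) ≤ L := hL ⟨g₁, rfl⟩ ⟨g₂, rfl⟩
  linarith [dist_triangle4_right (ρ h₁ x) (ρ h₂ x) (b g₁) (b g₂)]

/-! ### Isometric actions on tight spans -/

section Invariant

variable {G : Type u} [Group G] {X : Type v} [MetricSpace X] {B : ℝ} {F : G → X}

theorem CoarselyInvariant.bddAbove (hF : CoarselyInvariant 1 B F) (g h : G) :
    BddAbove (Set.range fun k => dist (F (k * g)) (F (k * h))) :=
  ⟨dist (F g) (F h) + B, by rintro _ ⟨k, rfl⟩; simpa using hF k g h⟩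

/-- The left-invariant pseudometric on `G` that makes a coarsely left-invariant map `F` isometric up
to an additive error: the supremum of the translates of the pulled back metric. -/
noncomputable abbrev CoarselyInvariant.pseudoMetric (hF : CoarselyInvariant 1 B F) :
    PseudoMetricSpace G where
  dist g h := ⨆ k, dist (F (k * g)) (F (k * h))
  dist_self g := by simp
  dist_comm g h := by simp only [dist_comm]
  dist_triangle g h l := ciSup_le fun k => (dist_triangle _ (F (k * h)) _).trans
    (add_le_add (le_ciSup (hF.bddAbove g h) k) (le_ciSup (hF.bddAbove h l) k))

/-- A group `G` with a coarsely left-invariant map `F` to a hyperbolic space whose image is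
quasi-convex acts on a hyperbolic space, with coarsely dense orbits that are isometric to `F` up to
an additive error. This space is the tight span of `G`. -/
theorem CoarselyInvariant.exists_action (hF : CoarselyInvariant 1 B F) {δ M : ℝ}
    (h4 : FourPoint X δ) (hX : IsGeodesicSpace X)
    (hM : ∀ g h (γ : ℝ → X), IsGeodesic γ (F g) (F h) → ∀ t ∈ Set.Icc 0 (dist (F g) (F h)),
      ∃ k, dist (γ t) (F k) ≤ M) :
    ∃ (Z : Type u) (_ : MetricSpace Z) (_ : MulAction G Z), IsIsometricSMul G Z ∧
      IsHyperbolicSpace Z ∧ ∃ e : G → Z, (∀ g h, g • e h = e (g * h)) ∧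
      (∀ g h, |dist (e g) (e h) - dist (F g) (F h)| ≤ B) ∧ ∃ D, ∀ z, ∃ g, dist z (e g) ≤ D := by
  let _ := hF.pseudoMetric
  have hdist : ∀ g h : G, dist (F g) (F h) ≤ dist g h ∧ dist g h ≤ dist (F g) (F h) + B := by
    intro g h
    refine ⟨?_, ciSup_le fun k => by simpa using hF k g h⟩
    have h1 := le_ciSup (hF.bddAbove g h) 1
    rw [one_mul, one_mul] at h1
    exact h1
  have hsmul : ∀ k g h : G, dist (k * g) (k * h) ≤ dist g h := fun k g h =>
    ciSup_le fun l => by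
      rw [← mul_assoc, ← mul_assoc]
      exact le_ciSup (hF.bddAbove g h) (l * k)
  have hiso : IsIsometricSMul G G := ⟨fun k => Isometry.of_dist_eq fun g h =>
    le_antisymm (hsmul k g h) (by simpa using hsmul k⁻¹ (k * g) (k * h))⟩
  have hdist' : ∀ g h : G, |dist (F g) (F h) - dist g h| ≤ B := fun g h => by
    rw [abs_sub_comm, abs_of_nonneg (sub_nonneg.2 (hdist g h).1)]
    linarith [(hdist g h).2]
  have h4' : FourPoint G (δ + 4 * B) := h4.of_dist_le F hdist'
  have hrough : RoughlyGeodesic G (B + M) := by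
    intro g h r hr
    have hB : 0 ≤ B := (abs_nonneg _).trans (hdist' 1 1)
    obtain ⟨γ, hγ⟩ := hX (F g) (F h)
    have ht : min r (dist (F g) (F h)) ∈ Set.Icc 0 (dist (F g) (F h)) :=
      ⟨le_min hr.1 dist_nonneg, min_le_right _ _⟩
    obtain ⟨k, hk⟩ := hM g h γ hγ _ ht
    have e1 := hγ.dist_left ht
    have e2 := hγ.dist_right ht
    set p := γ (min r (dist (F g) (F h)))
    have h1 := dist_triangle (F g) p (F k)
    have h2 := dist_triangle (F k) p (F h)
    rw [dist_comm (F k) p] at h2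
    refine ⟨k, ?_, ?_⟩
    · linarith [(hdist g k).2, min_le_left r (dist (F g) (F h))]
    · rcases min_choice r (dist (F g) (F h)) with h' | h' <;> rw [h'] at e2
      · linarith [(hdist k h).2, (hdist g h).1]
      · linarith [(hdist k h).2, hr.2]
  refine ⟨TightSpan G, inferInstance, inferInstance, inferInstance,
    TightSpan.isHyperbolicSpace h4' hrough, TightSpan.kuratowski,
    fun g h => TightSpan.smul_kuratowski g h, fun g h => ?_, _,
    TightSpan.exists_dist_kuratowski_le h4' hrough⟩
  rw [TightSpan.dist_kuratowski, abs_sub_comm]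
  exact hdist' g h

/-- In an isometric action with an equivariant map `e` from the group, the distances of the points
of an orbit are those of the values of `e`, up to an additive error. -/
theorem abs_dist_smul_sub_le {Z : Type w} [MetricSpace Z] [MulAction G Z] [IsIsometricSMul G Z]
    {e : G → Z} (he : ∀ g h, g • e h = e (g * h)) (z : Z) (g h : G) :
    |dist (g • z) (h • z) - dist (e g) (e h)| ≤ 2 * dist z (e 1) := by
  have key : ∀ g, dist (g • z) (e g) = dist z (e 1) := fun g => by
    rw [← dist_smul g z, he, mul_one]
  have h1 := dist_triangle4_right (g • z) (h • z) (e g) (e h)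
  have h2 := dist_triangle4_left (g • z) (h • z) (e g) (e h)
  rw [key, key] at h1 h2
  rw [abs_le]
  constructor <;> linarith

end Invariant

/-! ### Property (PH') -/

theorem PropertyPH'.of_quasiIsomorphism {G H : Type u} [Group G] [Group H] {φ : G → H}
    (hφ : IsQuasiIsomorphism φ) (h : PropertyPH' H) : PropertyPH' G := by
  obtain ⟨n, X, mX, aX, hiso, hhyp, hcob, hprop⟩ := h
  have x : ∀ i, X i := fun i => (hhyp i).1.some
  have key : ∀ i, ∃ (Z : Type u) (_ : MetricSpace Z) (_ : MulAction G Z), IsIsometricSMul G Z ∧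
      IsHyperbolicSpace Z ∧ ∃ e : G → Z, (∀ g h, g • e h = e (g * h)) ∧
      (∃ B, ∀ g h, |dist (e g) (e h) - dist (φ g • x i) (φ h • x i)| ≤ B) ∧
      ∃ D, ∀ z, ∃ g, dist z (e g) ≤ D := by
    intro i
    have := hiso i
    obtain ⟨-, hgeo, δ, hslim⟩ := hhyp i
    obtain ⟨B, -, hF⟩ :=
      (isQuasiAction_smul (H := H) (X := X i)).exists_coarselyInvariant hφ.1 (x i)
    obtain ⟨C, hC⟩ := hcob i (x i)
    obtain ⟨E, hE, hE'⟩ := hφ.exists_coarse_onto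
    obtain ⟨N, hN, hN'⟩ := exists_bound_of_finite hE fun e => dist (e • x i) (x i)
    have hdense : ∀ y : X i, ∃ g, dist y (φ g • x i) ≤ C + N := by
      intro y
      obtain ⟨h, hh⟩ := hC y
      obtain ⟨g, e, he, rfl⟩ := hE' h
      refine ⟨g, (dist_triangle _ _ _).trans (add_le_add hh ?_)⟩
      rw [mul_smul, dist_smul]
      exact hN' e he
    obtain ⟨Z, mZ, aZ, h1, h2, e, h3, h4, h5⟩ := hF.exists_action
      (SlimTriangles.fourPoint hslim hgeo) hgeo (fun g h γ _ t _ => hdense (γ t))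
    exact ⟨Z, mZ, aZ, h1, h2, e, h3, ⟨B, h4⟩, h5⟩
  choose Z mZ aZ hisoZ hhypZ e he hB D hD using key
  choose B hB using hB
  refine ⟨n, Z, mZ, aZ, hisoZ, hhypZ, fun i z => ?_, fun z R => ?_⟩
  · have := hisoZ i
    obtain ⟨g₀, hg₀⟩ := hD i z
    refine ⟨D i + D i, fun y => ?_⟩
    obtain ⟨g, hg⟩ := hD i y
    refine ⟨g * g₀⁻¹, (dist_triangle_right _ _ (e i g)).trans (add_le_add hg ?_)⟩
    have h1 : e i g = (g * g₀⁻¹) • e i g₀ := by rw [he, inv_mul_cancel_right]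
    rw [h1, dist_smul]
    exact hg₀
  · refine (hφ.finite_preimage (hprop x (R + ∑ i, (2 * dist (z i) (e i 1) + B i +
      dist (x i) (φ 1 • x i))))).subset fun g hg => ?_
    simp only [Set.mem_preimage, Set.mem_ofPred_eq, l1Dist] at hg ⊢
    refine le_trans ?_ (add_le_add_left hg _)
    rw [← Finset.sum_add_distrib]
    refine Finset.sum_le_sum fun i _ => ?_
    have := hisoZ i
    have h1 := abs_le.1 (abs_dist_smul_sub_le (he i) (z i) 1 g)
    have h2 := abs_le.1 (hB i 1 g)
    rw [one_smul] at h1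
    linarith [h1.1, h2.1, dist_triangle (x i) (φ 1 • x i) (φ g • x i)]

/-! ### Property (QT') -/

/-- A space with a coarsely dense map from a set `ι` is a quasi-tree if its metric on `ι` is, up to
an additive error, that of a coarsely connected family of points in a space that embeds
quasi-isometrically into a tree. -/
theorem isQuasiTree_of_coarselyConnected {X : Type v} [MetricSpace X] {T Z : Type u}
    [MetricSpace T] [MetricSpace Z] {ι : Type w} [Nonempty ι] {R : ι → ι → Prop} {F : ι → X}
    {e : ι → Z} {K C B D J : ℝ} {f : X → T} (hf : IsQIEmbedding K C f) (hT : IsMetricTree T)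
    (hR : ∀ i j, Relation.ReflTransGen R i j) (hJ : ∀ i j, R i j → dist (F i) (F j) ≤ J)
    (hZ : IsGeodesicSpace Z) (hB : ∀ i j, |dist (e i) (e j) - dist (F i) (F j)| ≤ B)
    (hD : ∀ z, ∃ i, dist z (e i) ≤ D) : IsQuasiTree Z := by
  have hK := hf.one_le
  have hK0 : 0 < K := one_pos.trans_le hK
  have hC := hf.nonneg
  obtain ⟨A, hA, b, hb, M, hM, hM'⟩ := hT.exists_subtree (F := fun i => f (F i)) (J := K * |J| + C)
    hR fun i j hij => (hf.upper _ _).trans (by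
      gcongr
      exact (hJ i j hij).trans (le_abs_self J))
  choose c hc using hD
  obtain ⟨i₀⟩ := ‹Nonempty ι›
  have hB0 : 0 ≤ B := (abs_nonneg _).trans (hB i₀ i₀)
  have hD0 : 0 ≤ D := dist_nonneg.trans (hc (e i₀))
  have hupper : ∀ i j, dist (b i) (b j) ≤ K * (dist (e i) (e j) + B) + C + 2 := by
    intro i j
    have h1 := dist_triangle4_left (f (F i)) (f (F j)) (b i : T) (b j)
    have h2 := hf.upper (F i) (F j)
    have h3 : dist (F i) (F j) ≤ dist (e i) (e j) + B := by linarith [(abs_le.1 (hB i j)).1]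
    have h4 := mul_le_mul_of_nonneg_left h3 hK0.le
    change dist (b i : T) (b j) ≤ _
    linarith [hb i, hb j]
  have hlower : ∀ i j, dist (e i) (e j) ≤ K * (dist (b i) (b j) + 2 + C) + B := by
    intro i j
    have h1 := dist_triangle4_right (f (F i)) (f (F j)) (b i : T) (b j)
    have h2 := hf.dist_le (F i) (F j)
    have h3 : dist (f (F i)) (f (F j)) + C ≤ dist (b i) (b j) + 2 + C := by
      change _ ≤ dist (b i : T) (b j) + 2 + C
      linarith [hb i, hb j]
    have h4 := mul_le_mul_of_nonneg_left h3 hK0.le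
    linarith [(abs_le.1 (hB i j)).2]
  have hKB : B + 2 * D ≤ K * (B + 2 * D) := le_mul_of_one_le_left (by positivity) hK
  refine ⟨hZ, A, inferInstance, hA, K, K * (B + 2 * D) + C + 2 + M, fun z => b (c z),
    ⟨⟨hK, by positivity, fun x y => ?_, fun x y => ?_⟩, fun p => ?_⟩⟩
  · rw [sub_le_iff_le_add, inv_mul_le_iff₀ hK0]
    have h1 := dist_triangle4_right x y (e (c x)) (e (c y))
    have h2 : 0 ≤ K * M := by positivity
    have h3 := mul_le_mul_of_nonneg_left hKB hK0.le
    linarith [hlower (c x) (c y), hc x, hc y]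
  · have h1 := dist_triangle4_left x y (e (c x)) (e (c y))
    have h2 : dist (e (c x)) (e (c y)) + B ≤ dist x y + (B + 2 * D) := by linarith [hc x, hc y]
    have h3 := mul_le_mul_of_nonneg_left h2 hK0.le
    linarith [hupper (c x) (c y)]
  · obtain ⟨i, hi⟩ := hM' p
    refine ⟨e i, ?_⟩
    have h1 := hupper i (c (e i))
    have h2 := dist_triangle p (b i) (b (c (e i)))
    have h3 : dist (e i) (e (c (e i))) + B ≤ B + 2 * D := by linarith [hc (e i)]
    have h4 := mul_le_mul_of_nonneg_left h3 hK0.le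
    linarith

theorem PropertyQT'.of_quasiIsomorphism {G H : Type u} [Group G] [Group H] {φ : G → H}
    (hφ : IsQuasiIsomorphism φ) (hG : Group.FG G) (h : PropertyQT' H) : PropertyQT' G := by
  obtain ⟨n, X, mX, aX, hiso, hqt, S, hSf, hS, hqi⟩ := h
  obtain ⟨S', hSf', hS'⟩ := exists_finite_generators hG
  have hne : ∀ i, Nonempty (X i) := fun i => by
    obtain ⟨-, T, mT, ⟨-, -, V, Γ, hΓ, -⟩, K, C, f, hf⟩ := hqt i
    exact ⟨(hf.coarse_onto hΓ.connected.nonempty.some).choose⟩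
  have x : ∀ i, X i := fun i => (hne i).some
  have key : ∀ i, ∃ (Z : Type u) (_ : MetricSpace Z) (_ : MulAction G Z), IsIsometricSMul G Z ∧
      IsQuasiTree Z ∧ ∃ e : G → Z, (∀ g h, g • e h = e (g * h)) ∧
      (∃ B, ∀ g h, |dist (e g) (e h) - dist (φ g • x i) (φ h • x i)| ≤ B) := by
    intro i
    have := hiso i
    obtain ⟨hgeo, T, mT, hT, K, C, f, hf⟩ := hqt i
    have hf := hf.toIsQIEmbedding
    have hT4 : FourPoint T 0 := fun x y z w => by simpa using hT.2.1 x y z w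
    obtain ⟨δ, hslim⟩ := hf.exists_slimTriangles hT4 hT.1
    obtain ⟨B, -, hF⟩ :=
      (isQuasiAction_smul (H := H) (X := X i)).exists_coarselyInvariant hφ.1 (x i)
    obtain ⟨J, hJ⟩ := hF.exists_step_le zero_le_one hSf'
    have hR := reflTransGen_of_closure_eq_top hS'
    obtain ⟨M, hM⟩ := hf.exists_dist_geodesic_le hT4 hT.1 hR hJ
    obtain ⟨Z, mZ, aZ, h1, h2, e, h3, h4, D, hD⟩ :=
      hF.exists_action (hslim.fourPoint hgeo) hgeo hM
    exact ⟨Z, mZ, aZ, h1, isQuasiTree_of_coarselyConnected hf hT hR hJ h2.2.1 h4 hD, e, h3, B, h4⟩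
  choose Z mZ aZ hisoZ hqtZ e he B hB using key
  refine ⟨n, Z, mZ, aZ, hisoZ, hqtZ, S', hSf', hS', fun z => ?_⟩
  obtain ⟨K, C, hK, hC, hKC⟩ := hqi x
  obtain ⟨A, hA, hA'⟩ := hφ.exists_wordDist_bounds hSf' hS' hSf hS
  set c := ∑ i, (2 * dist (z i) (e i 1) + B i) with hc
  have hc0 : 0 ≤ c := Finset.sum_nonneg fun i _ =>
    add_nonneg (by positivity) ((abs_nonneg _).trans (hB i 1 1))
  have hl1 : ∀ g h : G, |l1Dist (fun i => g • z i) (fun i => h • z i) -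
      l1Dist (fun i => φ g • x i) (fun i => φ h • x i)| ≤ c := by
    intro g h
    simp only [l1Dist]
    rw [← Finset.sum_sub_distrib]
    refine (Finset.abs_sum_le_sum_abs _ _).trans (Finset.sum_le_sum fun i _ => ?_)
    have := hisoZ i
    exact (abs_sub_le _ (dist (e i g) (e i h)) _).trans
      (add_le_add (abs_dist_smul_sub_le (he i) (z i) g h) (hB i g h))
  have hK0 : 0 < K := one_pos.trans_le hK
  have hA0 : 0 < A := one_pos.trans_le hA
  refine ⟨A * K, C + c + 1, by nlinarith, by positivity, fun g h => ?_⟩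
  obtain ⟨h1, h2⟩ := hKC (φ g) (φ h)
  obtain ⟨h3, h4⟩ := hA' g h
  obtain ⟨h5, h6⟩ := abs_le.1 (hl1 g h)
  rw [sub_le_iff_le_add, inv_mul_le_iff₀ hK0] at h1
  constructor
  · rw [sub_le_iff_le_add, inv_mul_le_iff₀ (by positivity)]
    have h7 := mul_le_mul_of_nonneg_left h1 hA0.le
    have h8 : l1Dist (fun i => φ g • x i) (fun i => φ h • x i) + C ≤
        l1Dist (fun i => g • z i) (fun i => h • z i) + (C + c) := by linarith
    have h9 := mul_le_mul_of_nonneg_left h8 (mul_pos hA0 hK0).le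
    have h10 : A ≤ A * K := le_mul_of_one_le_right hA0.le hK
    linarith
  · have h7 := mul_le_mul_of_nonneg_left h3 hK0.le
    linarith

end CoarseGroup

theorem proposition1p5 (G H : Type u) [Group G] [Group H]
    (hGH : CoarseGroup.QuasiIsomorphic G H) :
    (CoarseGroup.AlmostCommutative G ↔ CoarseGroup.AlmostCommutative H) ∧
    (Group.FG G → Group.FG H → (CoarseGroup.PropertyQFA G ↔ CoarseGroup.PropertyQFA H)) ∧
    (CoarseGroup.PropertyPH' G ↔ CoarseGroup.PropertyPH' H) ∧
    (Group.FG G → Group.FG H → (CoarseGroup.PropertyQT' G ↔ CoarseGroup.PropertyQT' H)) := by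
  obtain ⟨ψ, hψ⟩ := hGH.symm
  obtain ⟨φ, hφ⟩ := hGH
  exact ⟨⟨.of_quasiIsomorphism hψ, .of_quasiIsomorphism hφ⟩,
    fun hG hH => ⟨.of_quasiIsomorphism hφ hG, .of_quasiIsomorphism hψ hH⟩,
    ⟨.of_quasiIsomorphism hψ, .of_quasiIsomorphism hφ⟩,
    fun hG hH => ⟨.of_quasiIsomorphism hψ hH, .of_quasiIsomorphism hφ hG⟩⟩
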